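/- **Setting.** A *snapshot algorithm* for $n$ processes $p_0,\dots,p_{n-1}$ over a (possibly infinite) set $Vals$ is a parallel composition $p_0\|\cdots\|p_{n-1}$ of transition systems acting on a shared memory, with a fixed vector of initial values. From its initial state, $p_i$ has arrows for the first action of $\mathsf{scan}$ and of $\mathsf{update}(v)$ for every $v\in Vals$; the last action of a method returns $p_i$ to its initial state, and the last action of a $\mathsf{scan}$ returns a vector in $Vals^n$. An *execution* is a finite sequence of actions that the processes can perform from the initial state of the system. A high-level event is an operation in an execution, given by the positions $(s,t)$ of its first and last action, with $t=\infty$ if it is pending; in addition every process has an initial update event, carrying its initial value, and these $n$ events precede all other events. Event $(s_1,t_1)$ *precedes* $(s_2,t_2)$ if $t_1<s_2$. An execution is *linearizable* if there are a set $\mathcal E$ of its events that contains all the complete ones and a linear order $\prec$ on $\mathcal E$ extending precedence such that every complete scan in $\mathcal E$ returns, at each entry $i$, the argument of the $\prec$-last $p_i$-update before it. The algorithm is *correct* if all its executions are linearizable. Two executions are *similar* if they have the same length, their $l$-th actions are by the same process for all $l$, and every process executes the same sequence of kinds of operations (scan or update) in both. The algorithm is *schedule-based* if for every execution $\tau$ there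 are functions $\alpha_i$ ($i<n$) from the complete scan events of $\tau$ to its $p_i$-update events such that every execution $\tau'$ similar to $\tau$ has the same $p_i$-scan events and the same $p_i$-update events (as pairs $(s,t)$) as $\tau$, for every $i$, and every complete scan $S$ returns in $\tau'$ the vector of the arguments that $\alpha_0(S),\dots,\alpha_{n-1}(S)$ have in $\tau'$. It is understood that arguments do not block processes: if $\tau,\tau'$ are similar executions and $p_i$ can take a further step after $\tau$, then it can take one after $\tau'$ (for example, every process can always take a step). Fix two distinct values $0,1\in Vals$. The algorithm is *finite* if only finitely many states of the system are reachable when only $\mathsf{scan}$, $\mathsf{update}(0)$ and $\mathsf{update}(1)$ are invoked. **Corollary.** It is decidable whether a finite schedule-based snapshot algorithm is correct. Precisely: for every finite schedule-based algorithm, the part of the system that is reachable when only $\mathsf{scan}$, $\mathsf{update}(0)$ and $\mathsf{update}(1)$ are invoked can be written as a finite table (number of processes, initial values, initial state and list of labelled transitions, with states and values named injectively by natural numbers and $0,1$ named $0,1$); and there is a single computable function, the same for all $n$ and all $Vals$, that from any such table determines whether the algorithm is correct, that is, whether all its executions, with arbitrary update arguments from $Vals$, are linearizable. -/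

import Mathlib

universe u v w

namespace Snapshot

/-- Low-level actions: the first action of a `scan` or of an `update(x)`, an action in the middle
of an operation, and the last action of an operation. The last action of a `scan` carries the
returned vector. `V` is the type of update arguments and `R` the type of returned vectors. -/
inductive Action (V : Type u) (R : Type v) : Type (max u v)
  | startScan
  | startUpdate (x : V)
  | internal
  | endScan (r : R)
  | endUpdate

namespace Action

/-- First action of an operation? If so, is the operation a scan? -/
def startKind {V : Type u} {R : Type v} : Action V R → Option Bool
  | startScan => some true
  | startUpdate _ => some false
  | _ => none

/-- Last action of an operation. -/
def IsEnd {V : Type u} {R : Type v} : Action V R → Prop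
  | endScan _ => True
  | endUpdate => True
  | _ => False

/-- The action does not invoke an update with an argument outside `{x₀, x₁}`. -/
def IsBinary {V : Type u} {R : Type v} (x₀ x₁ : V) : Action V R → Prop
  | startUpdate x => x = x₀ ∨ x = x₁
  | _ => True

/-- Rename arguments and results. -/
def map {V : Type u} {R : Type v} {V' : Type*} {R' : Type*} (f : V → V') (g : R → R') :
    Action V R → Action V' R'
  | startScan => startScan
  | startUpdate x => startUpdate (f x)
  | internal => internal
  | endScan r => endScan (g r)
  | endUpdate => endUpdate

end Action

/-- The local state of a process: its initial state `idle`, a state of the transition system of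
`scan`, or a state of the transition system of `update`. -/
inductive LocalState (S : Type v) (U : Type v) : Type v
  | idle
  | scanning (c : S)
  | updating (c : U)

/-- A snapshot algorithm for `n` processes over the set of values `V`. Both methods of each process
are (nondeterministic) transition systems acting on a shared memory of arbitrary form. Entering a
method is its first action, leaving it (back to the initial state of the process) its last action.
In its initial state a process has arrows for `scan` and for `update(x)`, for every `x`.
`initVal i` is the value written by the initial update of process `i`, and `initMem` is the
memory after the initial updates. -/
structure Algorithm (n : ℕ) (V : Type u) where
  ScanLoc : Fin n → Type v
  UpdLoc : Fin n → Type v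
  Mem : Type w
  initVal : Fin n → V
  initMem : Mem
  scanStart : ∀ i, Mem → ScanLoc i → Mem → Prop
  scanStep : ∀ i, ScanLoc i → Mem → ScanLoc i → Mem → Prop
  scanEnd : ∀ i, ScanLoc i → Mem → (Fin n → V) → Mem → Prop
  updStart : ∀ i, V → Mem → UpdLoc i → Mem → Prop
  updStep : ∀ i, UpdLoc i → Mem → UpdLoc i → Mem → Prop
  updEnd : ∀ i, UpdLoc i → Mem → Mem → Prop
  scanStart_total : ∀ i m, ∃ c m', scanStart i m c m'
  updStart_total : ∀ i x m, ∃ c m', updStart i x m c m'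

/-- Executions are finite sequences of actions, each with the process that performs it. -/
abbrev Exec (n : ℕ) (V : Type u) : Type u := List (Fin n × Action V (Fin n → V))

/-- High-level events: the initial update of a process, a complete operation from its first action
(at position `s`) to its last action (at position `t`), and a pending operation whose first action
is at position `s`, that is, the pair `(s, ∞)`. -/
inductive Event (n : ℕ) : Type
  | initial (i : Fin n)
  | complete (s t : ℕ)
  | pending (s : ℕ)

section Events

variable {n : ℕ} {V : Type u}

/-- The action at position `l` is the first action, by process `i`, of an operation. -/
def IsFirst (τ : Exec n V) (i : Fin n) (l : ℕ) : Prop :=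
  ∃ a, τ[l]? = some (i, a) ∧ a.startKind ≠ none

/-- The action at position `l` is the last action, by process `i`, of an operation. -/
def IsLast (τ : Exec n V) (i : Fin n) (l : ℕ) : Prop :=
  ∃ a, τ[l]? = some (i, a) ∧ a.IsEnd

/-- `E` is a high-level event of process `i` in `τ`. -/
def IsEvent (τ : Exec n V) (i : Fin n) : Event n → Prop
  | .initial j => j = i
  | .complete s t => s < t ∧ IsFirst τ i s ∧ IsLast τ i t ∧ ∀ l, s < l → l < t → ¬ IsFirst τ i l
  | .pending s => IsFirst τ i s ∧ ∀ l, s < l → ¬ IsFirst τ i l ∧ ¬ IsLast τ i l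

/-- `E` is a scan event of process `i` in `τ`. -/
def IsScan (τ : Exec n V) (i : Fin n) (E : Event n) : Prop :=
  IsEvent τ i E ∧
    match E with
    | .initial _ => False
    | .complete s _ => τ[s]? = some (i, .startScan)
    | .pending s => τ[s]? = some (i, .startScan)

/-- `E` is an update event of process `i` in `τ`. -/
def IsUpdate (τ : Exec n V) (i : Fin n) (E : Event n) : Prop :=
  IsEvent τ i E ∧
    match E with
    | .initial _ => True
    | .complete s _ => ∃ x, τ[s]? = some (i, .startUpdate x)
    | .pending s => ∃ x, τ[s]? = some (i, .startUpdate x)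

/-- The event is not pending. -/
def Event.IsComplete : Event n → Prop
  | .pending _ => False
  | _ => True

/-- `E` is an update event with argument `x`. -/
def HasArg (initVal : Fin n → V) (τ : Exec n V) (E : Event n) (x : V) : Prop :=
  match E with
  | .initial i => x = initVal i
  | .complete s _ => ∃ i, τ[s]? = some (i, .startUpdate x)
  | .pending s => ∃ i, τ[s]? = some (i, .startUpdate x)

/-- `E` is a complete scan event that returns the vector `r`. -/
def Returns (τ : Exec n V) (E : Event n) (r : Fin n → V) : Prop :=
  match E with
  | .complete _ t => ∃ i, τ[t]? = some (i, .endScan r)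
  | _ => False

/-- Precedence of high-level events. The initial updates precede all other events. -/
def Precedes : Event n → Event n → Prop
  | .initial _, .initial _ => False
  | .initial _, _ => True
  | .complete _ t, .complete s _ => t < s
  | .complete _ t, .pending s => t < s
  | _, _ => False

/-- `τ` is linearizable with respect to the sequential specification of the snapshot object: there
are a set `H` with `complete(τ) ⊆ H ⊆ events(τ)` and a linear order `r` on `H` that extends
precedence (so the initial updates come first) such that each complete scan in `H` returns, at each
entry `i`, the argument of the `r`-last update of process `i` before it. -/
def Linearizable (initVal : Fin n → V) (τ : Exec n V) : Prop :=
  ∃ (H : Set (Event n)) (r : Event n → Event n → Prop),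
    (∀ i E, IsEvent τ i E → E.IsComplete → E ∈ H) ∧
    (∀ E ∈ H, ∃ i, IsEvent τ i E) ∧
    (∀ E ∈ H, ¬ r E E) ∧
    (∀ E ∈ H, ∀ F ∈ H, ∀ G ∈ H, r E F → r F G → r E G) ∧
    (∀ E ∈ H, ∀ F ∈ H, r E F ∨ E = F ∨ r F E) ∧
    (∀ E ∈ H, ∀ F ∈ H, Precedes E F → r E F) ∧
    ∀ S ∈ H, ∀ k, IsScan τ k S → S.IsComplete →
      ∃ z, Returns τ S z ∧
        ∀ i, ∃ U ∈ H, IsUpdate τ i U ∧ r U S ∧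
          (∀ U' ∈ H, IsUpdate τ i U' → r U' S → U' = U ∨ r U' U) ∧
          HasArg initVal τ U (z i)

/-- The successive operations of process `i` after its initial update, in order of invocation;
`true` stands for a scan and `false` for an update. -/
def opKinds (τ : Exec n V) (i : Fin n) : List Bool :=
  τ.filterMap fun e => if e.1 = i then e.2.startKind else none

/-- Two executions are similar if they have the same length, the actions at the same position are
by the same process, and each process executes the same sequence of procedures in both. -/
def Similar (τ τ' : Exec n V) : Prop :=
  τ.length = τ'.length ∧
  (∀ l : ℕ, (τ[l]?).map Prod.fst = (τ'[l]?).map Prod.fst) ∧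
  ∀ i, opKinds τ i = opKinds τ' i

/-- All arguments of (non-initial) updates are `x₀` or `x₁`. -/
def IsBinaryExec (x₀ x₁ : V) (τ : Exec n V) : Prop :=
  ∀ e ∈ τ, e.2.IsBinary x₀ x₁

end Events

namespace Algorithm

variable {n : ℕ} {V : Type u}

/-- The local state of process `i`. -/
abbrev Local (A : Algorithm.{u, v, w} n V) (i : Fin n) : Type v :=
  LocalState (A.ScanLoc i) (A.UpdLoc i)

/-- The states of the parallel composition of the processes over the shared memory. -/
abbrev State (A : Algorithm.{u, v, w} n V) : Type (max v w) :=
  (∀ i, A.Local i) × A.Mem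

/-- All processes are in their initial states. -/
def initState (A : Algorithm.{u, v, w} n V) : A.State :=
  (fun _ => .idle, A.initMem)

/-- The transitions of process `i`. -/
inductive LocalStep (A : Algorithm.{u, v, w} n V) (i : Fin n) :
    A.Local i → A.Mem → Action V (Fin n → V) → A.Local i → A.Mem → Prop
  | scanStart {m c m'} : A.scanStart i m c m' →
      LocalStep A i .idle m .startScan (.scanning c) m'
  | scanStep {c m c' m'} : A.scanStep i c m c' m' →
      LocalStep A i (.scanning c) m .internal (.scanning c') m'
  | scanEnd {c m z m'} : A.scanEnd i c m z m' →
      LocalStep A i (.scanning c) m (.endScan z) .idle m'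
  | updStart {x m c m'} : A.updStart i x m c m' →
      LocalStep A i .idle m (.startUpdate x) (.updating c) m'
  | updStep {c m c' m'} : A.updStep i c m c' m' →
      LocalStep A i (.updating c) m .internal (.updating c') m'
  | updEnd {c m m'} : A.updEnd i c m m' →
      LocalStep A i (.updating c) m .endUpdate .idle m'

/-- The transitions of the parallel composition: one process takes a step. -/
def Step (A : Algorithm.{u, v, w} n V) (s : A.State) (i : Fin n) (a : Action V (Fin n → V))
    (s' : A.State) : Prop :=
  ∃ c m, A.LocalStep i (s.1 i) s.2 a c m ∧ s' = (Function.update s.1 i c, m)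

/-- `A.Run τ s`: starting from the initial state, the processes can perform the sequence of
actions `τ` and arrive at the state `s`. -/
inductive Run (A : Algorithm.{u, v, w} n V) : Exec n V → A.State → Prop
  | nil : Run A [] A.initState
  | snoc {τ s i a s'} : Run A τ s → A.Step s i a s' → Run A (τ ++ [(i, a)]) s'

/-- `τ` is an execution of the algorithm. -/
def IsExec (A : Algorithm.{u, v, w} n V) (τ : Exec n V) : Prop := ∃ s, A.Run τ s

/-- The algorithm is correct: all its executions are linearizable. -/
def Correct (A : Algorithm.{u, v, w} n V) : Prop :=
  ∀ τ, A.IsExec τ → Linearizable A.initVal τ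

/-- Schedule-based algorithms: each execution `τ` has functions `α i` from its complete scan events
to its update events of process `i` such that every similar execution has the same scan and update
events as `τ`, and in it each complete scan `S` returns the vector of the arguments of the
updates `α i S`. -/
def ScheduleBased (A : Algorithm.{u, v, w} n V) : Prop :=
  ∀ τ, A.IsExec τ → ∃ α : Fin n → Event n → Event n,
    (∀ i k S, IsScan τ k S → S.IsComplete → IsUpdate τ i (α i S)) ∧
    ∀ τ', A.IsExec τ' → Similar τ τ' →
      (∀ i E, (IsScan τ i E ↔ IsScan τ' i E) ∧ (IsUpdate τ i E ↔ IsUpdate τ' i E)) ∧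
      ∀ k S, IsScan τ k S → S.IsComplete →
        ∃ z, Returns τ' S z ∧ ∀ i, HasArg A.initVal τ' (α i S) (z i)

/-- After the execution `τ`, process `i` can take a further step. -/
def CanStep (A : Algorithm.{u, v, w} n V) (τ : Exec n V) (i : Fin n) : Prop :=
  ∃ a, A.IsExec (τ ++ [(i, a)])

/-- Update arguments do not block processes: after similar executions, the same processes can take
a further step. This is the case in particular if every process can always take a step. -/
def ArgumentsDoNotBlock (A : Algorithm.{u, v, w} n V) : Prop :=
  ∀ τ τ', A.IsExec τ → A.IsExec τ' → Similar τ τ' → ∀ i, A.CanStep τ i → A.CanStep τ' i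

/-- The states reachable when only `scan`, `update(x₀)` and `update(x₁)` are invoked. -/
def binaryStates (A : Algorithm.{u, v, w} n V) (x₀ x₁ : V) : Set A.State :=
  {s | ∃ τ, IsBinaryExec x₀ x₁ τ ∧ A.Run τ s}

/-- The algorithm is finite: finitely many states are reachable when only `scan`, `update(x₀)` and
`update(x₁)` are invoked. -/
def IsFinite (A : Algorithm.{u, v, w} n V) (x₀ x₁ : V) : Prop :=
  (A.binaryStates x₀ x₁).Finite

/-- The values that occur when only `scan`, `update(x₀)` and `update(x₁)` are invoked: `x₀`, `x₁`,
the initial values, and all entries of vectors returned by scans. -/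
def binaryValues (A : Algorithm.{u, v, w} n V) (x₀ x₁ : V) : Set V :=
  {x₀, x₁} ∪ Set.range A.initVal ∪
    {x | ∃ s ∈ A.binaryStates x₀ x₁, ∃ i z s', A.Step s i (.endScan z) s' ∧ x ∈ Set.range z}

end Algorithm

/-- A finite transition system as an explicit finite object, with states and values named by
natural numbers: the number of processes, the initial values, the initial state, and the list of
transitions (source, process, action, target). This is the input of a decision procedure. -/
structure Table where
  procs : ℕ
  initVals : List ℕ
  start : ℕ
  trans : List (ℕ × ℕ × Action ℕ (List ℕ) × ℕ)

/-- `T` is a table of the part of the algorithm `A` that is reachable when only `scan`,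
`update(x₀)` and `update(x₁)` are invoked, for some naming `σ` of the states and some naming `enc`
of the values under which distinct ones get distinct names and `x₀`, `x₁` are called `0`, `1`. -/
def Table.Describes {n : ℕ} {V : Type u} (T : Table) (A : Algorithm.{u, v, w} n V)
    (x₀ x₁ : V) : Prop :=
  ∃ (σ : A.State → ℕ) (enc : V → ℕ),
    Set.InjOn σ (A.binaryStates x₀ x₁) ∧
    Set.InjOn enc (A.binaryValues x₀ x₁) ∧
    enc x₀ = 0 ∧ enc x₁ = 1 ∧
    T.procs = n ∧
    T.initVals = List.ofFn (fun i => enc (A.initVal i)) ∧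
    T.start = σ A.initState ∧
    ∀ e, e ∈ T.trans ↔
      ∃ s ∈ A.binaryStates x₀ x₁, ∃ i a s', A.Step s i a s' ∧ a.IsBinary x₀ x₁ ∧
        e = (σ s, (i : ℕ), a.map enc (fun z => List.ofFn (fun k => enc (z k))), σ s')

/-! ### Tables can be coded by natural numbers, so that computability applies to them -/

/-- Actions as elements of a sum type. -/
def Action.equivSum (V : Type u) (R : Type v) : Action V R ≃ Option V ⊕ Option (Option R) where
  toFun
    | .startScan => .inl none
    | .startUpdate x => .inl (some x)
    | .internal => .inr none
    | .endUpdate => .inr (some none)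
    | .endScan r => .inr (some (some r))
  invFun
    | .inl none => .startScan
    | .inl (some x) => .startUpdate x
    | .inr none => .internal
    | .inr (some none) => .endUpdate
    | .inr (some (some r)) => .endScan r
  left_inv a := by cases a <;> rfl
  right_inv b := by rcases b with (_ | _) | (_ | _ | _) <;> rfl

instance {V : Type u} {R : Type v} [Primcodable V] [Primcodable R] : Primcodable (Action V R) :=
  Primcodable.ofEquiv _ (Action.equivSum V R)

/-- Tables as tuples. -/
def Table.equivProd :
    Table ≃ ℕ × List ℕ × ℕ × List (ℕ × ℕ × Action ℕ (List ℕ) × ℕ) where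
  toFun T := (T.procs, T.initVals, T.start, T.trans)
  invFun p := ⟨p.1, p.2.1, p.2.2.1, p.2.2.2⟩
  left_inv _ := rfl
  right_inv _ := rfl

instance : Primcodable Table := Primcodable.ofEquiv _ Table.equivProd

end Snapshot

/-! In a schedule-based algorithm the update `α i S` of process `i` that a complete scan `S` reads
depends only on the schedule, not on the arguments. Hence correctness becomes a property of the
assignments `α`. If `α` is `Consistent`, the execution is linearizable: no scan reads an update that
it precedes, none misses an update that precedes it, the scans are totally ordered by what they read
and this order respects precedence, and what a scan reads is closed under precedence of updates. The
linear order comes from a sort key that counts the complete scans forced to come before an event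
(`Consistent.linearizable`).

If a consistency condition fails, two values suffice to expose it. Arguments can be chosen freely
without changing the schedule (`exists_similar_of_args`), so each process `i` can be made to write a
low value before a threshold and a high one from it on. Then entry `i` of a scan is high exactly if
the scan reads an update at or after the threshold (`exists_threshold_exec`). For suitable
thresholds the failure shows up as a `Violation`, a pattern of high and low entries that involves
the values of only two processes `i`, `j` and the scans of a third process `k`
(`consistent_of_no_violation`). Conversely, such a pattern excludes every linearization
(`Violation.not_linearizable`).

For fixed `i`, `j`, `k` the pattern is recognized by a finite monitor made of flags that are never
reset. Thus the algorithm is correct iff no monitor accepts a binary execution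
(`correct_iff_forall_accepts`). For a finite algorithm this is a reachability question in the
product of its table with the monitor. The search is primitive recursive in the table, uniformly in
`n` and the set of values. A table exists because scans return only arguments and initial values, so
that binary executions involve finitely many values. -/

namespace Snapshot

/-! ### Alternation of first and last actions. -/

section Positions

variable {n : ℕ} {V : Type u}

theorem getElem?_snoc_eq_some_iff {α : Type*} (τ : List α) (e x : α) (l : ℕ) :
    (τ ++ [e])[l]? = some x ↔ τ[l]? = some x ∨ (l = τ.length ∧ e = x) := by
  rcases lt_trichotomy l τ.length with h | h | h
  · rw [List.getElem?_append_left h]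
    exact ⟨Or.inl, fun h' => h'.elim id fun h'' => absurd h''.1 h.ne⟩
  · subst h
    simp
  · rw [List.getElem?_eq_none (by simp; omega), List.getElem?_eq_none (by omega)]
    simp [h.ne']

theorem lt_length_of_getElem?_eq_some {α : Type*} {τ : List α} {x : α} {l : ℕ}
    (h : τ[l]? = some x) : l < τ.length :=
  (List.getElem?_eq_some_iff.1 h).1

theorem isFirst_snoc (τ : Exec n V) (p : Fin n) (a : Action V (Fin n → V)) (i : Fin n) (l : ℕ) :
    IsFirst (τ ++ [(p, a)]) i l ↔
      IsFirst τ i l ∨ (l = τ.length ∧ p = i ∧ a.startKind ≠ none) := by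
  simp only [IsFirst, getElem?_snoc_eq_some_iff, Prod.mk.injEq]
  grind

theorem isLast_snoc (τ : Exec n V) (p : Fin n) (a : Action V (Fin n → V)) (i : Fin n) (l : ℕ) :
    IsLast (τ ++ [(p, a)]) i l ↔ IsLast τ i l ∨ (l = τ.length ∧ p = i ∧ a.IsEnd) := by
  simp only [IsLast, getElem?_snoc_eq_some_iff, Prod.mk.injEq]
  grind

theorem IsFirst.lt_length {τ : Exec n V} {i : Fin n} {l : ℕ} (h : IsFirst τ i l) :
    l < τ.length :=
  let ⟨_, h, _⟩ := h
  lt_length_of_getElem?_eq_some h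

theorem IsLast.lt_length {τ : Exec n V} {i : Fin n} {l : ℕ} (h : IsLast τ i l) :
    l < τ.length :=
  let ⟨_, h, _⟩ := h
  lt_length_of_getElem?_eq_some h

theorem IsFirst.not_isLast {τ : Exec n V} {i j : Fin n} {l : ℕ} (h : IsFirst τ i l) :
    ¬ IsLast τ j l := by
  rintro ⟨b, hb, hb'⟩
  obtain ⟨a, ha, ha'⟩ := h
  obtain ⟨-, rfl⟩ := Prod.mk.inj (Option.some.inj (ha.symm.trans hb))
  cases a <;> simp_all [Action.startKind, Action.IsEnd]

theorem IsFirst.process_eq {τ : Exec n V} {i j : Fin n} {l : ℕ} (h : IsFirst τ i l)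
    (h' : IsFirst τ j l) : i = j := by
  obtain ⟨a, ha, -⟩ := h
  obtain ⟨b, hb, -⟩ := h'
  exact (Prod.mk.inj (Option.some.inj (ha.symm.trans hb))).1

theorem isFirst_of_startScan {τ : Exec n V} {i : Fin n} {l : ℕ}
    (h : τ[l]? = some (i, .startScan)) : IsFirst τ i l :=
  ⟨_, h, by simp [Action.startKind]⟩

theorem isFirst_of_startUpdate {τ : Exec n V} {i : Fin n} {l : ℕ} {x : V}
    (h : τ[l]? = some (i, .startUpdate x)) : IsFirst τ i l :=
  ⟨_, h, by simp [Action.startKind]⟩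

theorem isLast_of_endScan {τ : Exec n V} {i : Fin n} {l : ℕ} {z : Fin n → V}
    (h : τ[l]? = some (i, .endScan z)) : IsLast τ i l :=
  ⟨_, h, by simp [Action.IsEnd]⟩

/-- No operation of process `i` starts or ends strictly between the two positions. -/
def QuietBetween (τ : Exec n V) (i : Fin n) (s t : ℕ) : Prop :=
  ∀ l, s < l → l < t → ¬ IsFirst τ i l ∧ ¬ IsLast τ i l

/-- First and last actions of each process alternate, and the kinds of a last action and of the
preceding first action agree. -/
structure WellFormed (τ : Exec n V) : Prop where
  exists_startScan : ∀ {i t z}, τ[t]? = some (i, .endScan z) →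
    ∃ s < t, τ[s]? = some (i, .startScan) ∧ QuietBetween τ i s t
  exists_startUpdate : ∀ {i t}, τ[t]? = some (i, .endUpdate) →
    ∃ s < t, ∃ x, τ[s]? = some (i, .startUpdate x) ∧ QuietBetween τ i s t
  exists_isLast : ∀ {i s s'}, IsFirst τ i s → IsFirst τ i s' → s < s' →
    ∃ t, s < t ∧ t < s' ∧ IsLast τ i t

theorem QuietBetween.snoc {τ : Exec n V} {i : Fin n} {s t : ℕ} (h : QuietBetween τ i s t)
    (ht : t ≤ τ.length) (e : Fin n × Action V (Fin n → V)) :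
    QuietBetween (τ ++ [e]) i s t := by
  intro l hs hl
  obtain ⟨p, a⟩ := e
  rw [isFirst_snoc, isLast_snoc]
  have := h l hs hl
  refine ⟨?_, ?_⟩
  · rintro (h' | h')
    exacts [this.1 h', by omega]
  · rintro (h' | h')
    exacts [this.2 h', by omega]

/-- Only the appended position imposes new conditions: a first action needs the earlier operations
of its process to be over, and a last action needs an open operation of the matching kind. -/
theorem WellFormed.snoc {τ : Exec n V} (h : WellFormed τ) {p : Fin n}
    {a : Action V (Fin n → V)}
    (hstart : a.startKind ≠ none → ∀ l, IsFirst τ p l → ∃ t, l < t ∧ IsLast τ p t)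
    (hscan : ∀ z, a = .endScan z → ∃ s, τ[s]? = some (p, .startScan) ∧
      QuietBetween τ p s τ.length)
    (hupd : a = .endUpdate → ∃ s x, τ[s]? = some (p, .startUpdate x) ∧
      QuietBetween τ p s τ.length) :
    WellFormed (τ ++ [(p, a)]) where
  exists_startScan {i t z} ht := by
    simp only [getElem?_snoc_eq_some_iff] at ht ⊢
    rcases ht with ht | ⟨rfl, ht⟩
    · obtain ⟨s, hs, hs', hq⟩ := h.exists_startScan ht
      exact ⟨s, hs, Or.inl hs', hq.snoc (lt_length_of_getElem?_eq_some ht).le _⟩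
    · obtain ⟨rfl, rfl⟩ := Prod.mk.inj ht
      obtain ⟨s, hs, hq⟩ := hscan z rfl
      exact ⟨s, lt_length_of_getElem?_eq_some hs, Or.inl hs, hq.snoc le_rfl _⟩
  exists_startUpdate {i t} ht := by
    simp only [getElem?_snoc_eq_some_iff] at ht ⊢
    rcases ht with ht | ⟨rfl, ht⟩
    · obtain ⟨s, hs, x, hs', hq⟩ := h.exists_startUpdate ht
      exact ⟨s, hs, x, Or.inl hs', hq.snoc (lt_length_of_getElem?_eq_some ht).le _⟩
    · obtain ⟨rfl, rfl⟩ := Prod.mk.inj ht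
      obtain ⟨s, x, hs, hq⟩ := hupd rfl
      exact ⟨s, lt_length_of_getElem?_eq_some hs, x, Or.inl hs, hq.snoc le_rfl _⟩
  exists_isLast {i s s'} hs hs' hlt := by
    rw [isFirst_snoc] at hs hs'
    simp only [isLast_snoc]
    rcases hs with hs | ⟨rfl, rfl, ha⟩
    · rcases hs' with hs' | ⟨rfl, rfl, ha⟩
      · obtain ⟨t, h1, h2, h3⟩ := h.exists_isLast hs hs' hlt
        exact ⟨t, h1, h2, Or.inl h3⟩
      · obtain ⟨t, h1, h2⟩ := hstart ha s hs
        exact ⟨t, h1, h2.lt_length, Or.inl h2⟩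
    · rcases hs' with hs' | hs'
      · exact absurd hs'.lt_length (by omega)
      · exact absurd hs'.1 hlt.ne'

end Positions

/-! ### Local states and pending operations. -/

namespace Algorithm

variable {n : ℕ} {V : Type u} {A : Algorithm.{u, v, w} n V}

/-- The local state of process `i` says which operation of `i`, if any, is pending in `τ`. -/
def StatusAgrees (τ : Exec n V) (i : Fin n) {S U : Type v} : LocalState S U → Prop
  | .idle => ∀ l, IsFirst τ i l → ∃ t, l < t ∧ IsLast τ i t
  | .scanning _ => ∃ l, IsScan τ i (.pending l)
  | .updating _ => ∃ l, IsUpdate τ i (.pending l)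

theorem statusAgrees_snoc_of_ne {τ : Exec n V} {i p : Fin n} (hne : p ≠ i)
    (a : Action V (Fin n → V)) {S U : Type v} {c : LocalState S U} (h : StatusAgrees τ i c) :
    StatusAgrees (τ ++ [(p, a)]) i c := by
  have hF : ∀ l, IsFirst (τ ++ [(p, a)]) i l ↔ IsFirst τ i l := fun l => by
    simp [isFirst_snoc, hne]
  have hL : ∀ l, IsLast (τ ++ [(p, a)]) i l ↔ IsLast τ i l := fun l => by
    simp [isLast_snoc, hne]
  cases c <;>
    simpa [StatusAgrees, IsScan, IsUpdate, IsEvent, hF, hL, getElem?_snoc_eq_some_iff, hne] using h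

theorem not_isFirst_and_not_isLast_snoc_of_gt {τ : Exec n V} {p : Fin n} {l : ℕ} (hl : τ.length ≤ l)
    (a : Action V (Fin n → V)) : ∀ l' > l, ¬ IsFirst (τ ++ [(p, a)]) p l' ∧
      ¬ IsLast (τ ++ [(p, a)]) p l' := fun l' hl' =>
  ⟨fun h => by have := h.lt_length; simp at this; omega,
    fun h => by have := h.lt_length; simp at this; omega⟩

theorem statusAgrees_snoc_internal {τ : Exec n V} {p : Fin n} {S U : Type v} {c : LocalState S U}
    (h : StatusAgrees τ p c) : StatusAgrees (τ ++ [(p, .internal)]) p c := by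
  have hF : ∀ l, IsFirst (τ ++ [(p, .internal)]) p l ↔ IsFirst τ p l := fun l => by
    simp [isFirst_snoc, Action.startKind]
  have hL : ∀ l, IsLast (τ ++ [(p, .internal)]) p l ↔ IsLast τ p l := fun l => by
    simp [isLast_snoc, Action.IsEnd]
  cases c <;>
    simpa [StatusAgrees, IsScan, IsUpdate, IsEvent, hF, hL, getElem?_snoc_eq_some_iff] using h

theorem statusAgrees_snoc_end {τ : Exec n V} {p : Fin n} {S U : Type v}
    {a : Action V (Fin n → V)} (ha : a.IsEnd) :
    StatusAgrees (τ ++ [(p, a)]) p (.idle : LocalState S U) := by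
  intro l hl
  refine ⟨τ.length, ?_, (isLast_snoc ..).2 (Or.inr ⟨rfl, rfl, ha⟩)⟩
  rcases (isFirst_snoc ..).1 hl with h | h
  · exact h.lt_length
  · cases a <;> simp_all [Action.IsEnd, Action.startKind]

/-- The two invariants need a joint induction: the local state decides whether the next action may
start or end an operation, and it carries this information only because it agrees with the past. -/
theorem Run.wellFormed_and_statusAgrees {τ : Exec n V} {s : A.State} (h : A.Run τ s) :
    WellFormed τ ∧ ∀ i, StatusAgrees τ i (s.1 i) := by
  induction h with
  | nil =>
    refine ⟨⟨by simp, by simp, fun h => ?_⟩, fun i l h => ?_⟩ <;>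
    · obtain ⟨a, ha, -⟩ := h
      simp at ha
  | @snoc τ s p a s' _ hstep ih =>
    obtain ⟨hwf, hst⟩ := ih
    obtain ⟨c, m, hloc, rfl⟩ := hstep
    have hp := hst p
    generalize hcp : s.1 p = cp at hp hloc
    -- The statuses of the other processes are not affected by a step of `p`.
    suffices hmain : WellFormed (τ ++ [(p, a)]) ∧ StatusAgrees (τ ++ [(p, a)]) p c by
      refine ⟨hmain.1, fun i => ?_⟩
      by_cases hi : i = p
      · subst hi
        simpa using hmain.2
      · simpa [Function.update_of_ne hi] using statusAgrees_snoc_of_ne (Ne.symm hi) a (hst i)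
    cases hloc with
    | scanStart _ =>
      refine ⟨hwf.snoc (fun _ => hp) (by simp) (by simp), τ.length, ⟨?_, ?_⟩, ?_⟩
      · exact isFirst_of_startScan ((getElem?_snoc_eq_some_iff ..).2 (Or.inr ⟨rfl, rfl⟩))
      · exact not_isFirst_and_not_isLast_snoc_of_gt le_rfl _
      · exact (getElem?_snoc_eq_some_iff ..).2 (Or.inr ⟨rfl, rfl⟩)
    | @updStart x _ _ _ _ =>
      refine ⟨hwf.snoc (fun _ => hp) (by simp) (by simp), τ.length, ⟨?_, ?_⟩, ?_⟩
      · exact isFirst_of_startUpdate ((getElem?_snoc_eq_some_iff ..).2 (Or.inr ⟨rfl, rfl⟩))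
      · exact not_isFirst_and_not_isLast_snoc_of_gt le_rfl _
      · exact ⟨x, (getElem?_snoc_eq_some_iff ..).2 (Or.inr ⟨rfl, rfl⟩)⟩
    | scanStep _ =>
      exact ⟨hwf.snoc (fun h => absurd rfl h) (by simp) (by simp), statusAgrees_snoc_internal hp⟩
    | updStep _ =>
      exact ⟨hwf.snoc (fun h => absurd rfl h) (by simp) (by simp), statusAgrees_snoc_internal hp⟩
    | scanEnd _ =>
      obtain ⟨l, hl, hl'⟩ := hp
      exact ⟨hwf.snoc (fun h => absurd rfl h) (fun z _ => ⟨l, hl', fun l' h _ => hl.2 l' h⟩)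
        (by simp), statusAgrees_snoc_end (by simp [Action.IsEnd])⟩
    | updEnd _ =>
      obtain ⟨l, hl, x, hl'⟩ := hp
      exact ⟨hwf.snoc (fun h => absurd rfl h) (by simp)
        (fun _ => ⟨l, x, hl', fun l' h _ => hl.2 l' h⟩),
        statusAgrees_snoc_end (by simp [Action.IsEnd])⟩

theorem IsExec.wellFormed {τ : Exec n V} (h : A.IsExec τ) : WellFormed τ :=
  let ⟨_, h⟩ := h
  h.wellFormed_and_statusAgrees.1

end Algorithm

/-! ### High-level events and their starting positions. -/

section Events

variable {n : ℕ} {V : Type u} {τ : Exec n V}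

/-- Start position of an event, shifted so that the initial events come first. -/
def Event.start : Event n → ℕ
  | .initial _ => 0
  | .complete s _ => s + 1
  | .pending s => s + 1

/-- The operation ends at the earliest last action of `i` after `s`. Another first action before
that position would, by alternation, be preceded by a still earlier last action. -/
theorem WellFormed.exists_event (h : WellFormed τ) {i : Fin n} {s : ℕ} (hs : IsFirst τ i s) :
    (∃ t, IsEvent τ i (.complete s t) ∧ ∀ l, s < l → IsLast τ i l → t ≤ l) ∨
      IsEvent τ i (.pending s) := by
  classical
  by_cases ht : ∃ t, s < t ∧ IsLast τ i t
  · refine Or.inl ⟨Nat.find ht, ⟨(Nat.find_spec ht).1, hs, (Nat.find_spec ht).2,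
      fun l h1 h2 hl => ?_⟩, fun l h1 h2 => Nat.find_min' ht ⟨h1, h2⟩⟩
    obtain ⟨t, h3, h4, h5⟩ := h.exists_isLast hs hl h1
    exact Nat.find_min ht (h4.trans h2) ⟨h3, h5⟩
  · refine Or.inr ⟨hs, fun l hl => ⟨fun hl' => ?_, fun hl' => ht ⟨l, hl, hl'⟩⟩⟩
    obtain ⟨t, h3, -, h5⟩ := h.exists_isLast hs hl' hl
    exact ht ⟨t, h3, h5⟩

theorem WellFormed.exists_isFirst_between (h : WellFormed τ) {i : Fin n} {t : ℕ}
    (ht : IsLast τ i t) : ∃ s < t, IsFirst τ i s ∧ QuietBetween τ i s t := by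
  obtain ⟨a, ha, ha'⟩ := ht
  cases a with
  | endScan z =>
    obtain ⟨s, h1, h2, h3⟩ := h.exists_startScan ha
    exact ⟨s, h1, isFirst_of_startScan h2, h3⟩
  | endUpdate =>
    obtain ⟨s, h1, x, h2, h3⟩ := h.exists_startUpdate ha
    exact ⟨s, h1, isFirst_of_startUpdate h2, h3⟩
  | _ => exact ha'.elim

/-- The later of two ends would need a first action of its own, with nothing of process `i` in
between; no position relative to the earlier end is possible for it. -/
theorem WellFormed.complete_unique (h : WellFormed τ) {i : Fin n} {s t t' : ℕ}
    (ht : IsEvent τ i (.complete s t)) (ht' : IsEvent τ i (.complete s t')) : t = t' := by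
  wlog hlt : t < t' generalizing t t'
  · rcases eq_or_lt_of_le (not_lt.1 hlt) with h' | h'
    · exact h'.symm
    · exact (this ht' ht h').symm
  obtain ⟨s', h1, h2, h3⟩ := h.exists_isFirst_between ht'.2.2.1
  rcases lt_trichotomy t s' with h4 | rfl | h4
  · exact absurd h2 (ht'.2.2.2 s' (ht.1.trans h4) h1)
  · exact absurd ht.2.2.1 h2.not_isLast
  · exact absurd ht.2.2.1 (h3 t h4 hlt).2

theorem IsEvent.isFirst {i : Fin n} {E : Event n} (h : IsEvent τ i E) {s : ℕ}
    (hs : E.start = s + 1) : IsFirst τ i s := by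
  cases E with
  | initial j => simp [Event.start] at hs
  | complete s' t => obtain rfl : s' = s := by simpa [Event.start] using hs
                     exact h.2.1
  | pending s' => obtain rfl : s' = s := by simpa [Event.start] using hs
                  exact h.1

/-- Positivity excludes the initial events, which all share start 0. For events of the same process
it is not needed. -/
theorem WellFormed.event_ext (h : WellFormed τ) {i j : Fin n} {E F : Event n}
    (hE : IsEvent τ i E) (hF : IsEvent τ j F) (hpos : 0 < E.start) (heq : E.start = F.start) :
    E = F := by
  obtain ⟨s, hs⟩ := Nat.exists_eq_succ_of_ne_zero hpos.ne'
  obtain rfl := (hE.isFirst hs).process_eq (hF.isFirst (heq ▸ hs))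
  cases E with
  | initial k => simp [Event.start] at hpos
  | complete s t =>
    cases F with
    | initial k => simp [Event.start] at heq
    | complete s' t' =>
      obtain rfl : s = s' := by simpa [Event.start] using heq
      rw [h.complete_unique hE hF]
    | pending s' =>
      obtain rfl : s = s' := by simpa [Event.start] using heq
      exact absurd hE.2.2.1 (hF.2 t hE.1).2
  | pending s =>
    cases F with
    | initial k => simp [Event.start] at heq
    | complete s' t' =>
      obtain rfl : s = s' := by simpa [Event.start] using heq
      exact absurd hF.2.2.1 (hE.2 t' hF.1).2
    | pending s' =>
      obtain rfl : s = s' := by simpa [Event.start] using heq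
      rfl

theorem WellFormed.event_ext_of_process (h : WellFormed τ) {i : Fin n} {E F : Event n}
    (hE : IsEvent τ i E) (hF : IsEvent τ i F) (heq : E.start = F.start) : E = F := by
  rcases Nat.eq_zero_or_pos E.start with h0 | hpos
  · cases E <;> cases F <;> simp_all [Event.start, IsEvent]
  · exact h.event_ext hE hF hpos heq

theorem Precedes.start_lt {i j : Fin n} {E F : Event n} (hE : IsEvent τ i E)
    (hF : IsEvent τ j F) (h : Precedes E F) : E.start < F.start := by
  cases E <;> cases F <;> simp_all [Precedes, Event.start, IsEvent] <;> omega

/-- Operations of a single process do not overlap, so the order of their starts is already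
precedence. -/
theorem precedes_of_start_lt {i : Fin n} {E F : Event n} (hE : IsEvent τ i E)
    (hF : IsEvent τ i F) (h : E.start < F.start) : Precedes E F := by
  cases E with
  | initial j => cases F <;> simp_all [Precedes, Event.start]
  | complete s t =>
    have key : ∀ s', IsFirst τ i s' → s < s' → t < s' := fun s' h1 h2 => by
      rcases lt_trichotomy t s' with h3 | rfl | h3
      · exact h3
      · exact absurd hE.2.2.1 h1.not_isLast
      · exact absurd h1 (hE.2.2.2 s' h2 h3)
    cases F with
    | initial j => simp [Event.start] at h
    | complete s' t' => exact key s' hF.2.1 (by simpa [Event.start] using h)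
    | pending s' => exact key s' hF.1 (by simpa [Event.start] using h)
  | pending s =>
    cases F with
    | initial j => simp [Event.start] at h
    | complete s' t' =>
      exact absurd hF.2.1 (hE.2 s' (by simpa [Event.start] using h)).1
    | pending s' =>
      exact absurd hF.1 (hE.2 s' (by simpa [Event.start] using h)).1

end Events

/-! ### Consistent assignments yield linearizations. -/

section Linearization

variable {n : ℕ} {V : Type u} {τ : Exec n V}

/-- `S` is a complete scan event of some process. -/
def IsCompleteScan (τ : Exec n V) (S : Event n) : Prop :=
  (∃ k, IsScan τ k S) ∧ S.IsComplete

theorem IsEvent.isUpdate_or_isScan {i : Fin n} {E : Event n} (h : IsEvent τ i E) :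
    IsUpdate τ i E ∨ IsScan τ i E := by
  have key : ∀ s, IsFirst τ i s → (∃ x, τ[s]? = some (i, .startUpdate x)) ∨
      τ[s]? = some (i, .startScan) := by
    rintro s ⟨a, ha, ha'⟩
    cases a with
    | startScan => exact Or.inr ha
    | startUpdate x => exact Or.inl ⟨x, ha⟩
    | _ => simp [Action.startKind] at ha'
  cases E with
  | initial j => exact Or.inl ⟨h, trivial⟩
  | complete s t => exact (key s h.2.1).imp (⟨h, ·⟩) (⟨h, ·⟩)
  | pending s => exact (key s h.1).imp (⟨h, ·⟩) (⟨h, ·⟩)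

theorem IsUpdate.not_isScan {i j : Fin n} {E : Event n} (h : IsUpdate τ i E) :
    ¬ IsScan τ j E := by
  rintro ⟨-, h'⟩
  obtain ⟨-, h⟩ := h
  cases E <;> simp_all

theorem IsUpdate.not_isCompleteScan {i : Fin n} {E : Event n} (h : IsUpdate τ i E) :
    ¬ IsCompleteScan τ E := fun ⟨⟨_, h'⟩, _⟩ => h.not_isScan h'

theorem IsEvent.process_eq {i j : Fin n} {E : Event n} (h : IsEvent τ i E)
    (h' : IsEvent τ j E) : i = j := by
  cases E with
  | initial k => exact h.symm.trans h'
  | complete s t => exact h.2.1.process_eq h'.2.1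
  | pending s => exact h.1.process_eq h'.1

theorem finite_setOf_isCompleteScan (τ : Exec n V) : {S | IsCompleteScan τ S}.Finite := by
  refine (((Set.finite_lt_nat τ.length).prod (Set.finite_lt_nat τ.length)).image
    (fun p => Event.complete p.1 p.2)).subset ?_
  rintro E ⟨⟨k, hE, hE'⟩, hc⟩
  cases E with
  | initial j => exact hE'.elim
  | complete s t => exact ⟨(s, t), ⟨hE.2.1.lt_length, hE.2.2.1.lt_length⟩, rfl⟩
  | pending s => exact hc.elim

/-- `α` assigns to each complete scan an update of each process in such a way that the scans can be
placed, consistently with precedence, directly after the updates they are assigned. -/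
structure Consistent (τ : Exec n V) (α : Fin n → Event n → Event n) : Prop where
  not_precedes : ∀ {S} i, IsCompleteScan τ S → ¬ Precedes S (α i S)
  latest : ∀ {S i U}, IsCompleteScan τ S → IsUpdate τ i U → Precedes U S →
    U.start ≤ (α i S).start
  chain : ∀ {S S'}, IsCompleteScan τ S → IsCompleteScan τ S' →
    (∀ i, (α i S).start ≤ (α i S').start) ∨ ∀ i, (α i S').start ≤ (α i S).start
  mono : ∀ {S S'}, IsCompleteScan τ S → IsCompleteScan τ S' → Precedes S S' →
    ∀ i, (α i S).start ≤ (α i S').start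
  closed : ∀ {S i j U U'}, IsCompleteScan τ S → IsUpdate τ i U → IsUpdate τ j U' →
    Precedes U U' → U'.start ≤ (α j S).start → U.start ≤ (α i S).start

/-- The complete scans that have to be linearized before the event `E`. -/
def scansBefore (τ : Exec n V) (α : Fin n → Event n → Event n) (E : Event n) : Set (Event n) :=
  {S | IsCompleteScan τ S ∧ ((∃ i, IsUpdate τ i E ∧ (α i S).start < E.start) ∨
    (IsCompleteScan τ E ∧ ∃ i, (α i S).start < (α i E).start))}

/-- Start position of an event, made injective on initial events. -/
def Event.rank : Event n → ℕ
  | .initial i => i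
  | .complete s _ => n + s
  | .pending s => n + s

open Classical in
/-- The sort key of an event in the linearization. -/
noncomputable def linKey (τ : Exec n V) (α : Fin n → Event n → Event n) (E : Event n) :
    ℕ ×ₗ ℕ ×ₗ ℕ :=
  toLex ((scansBefore τ α E).ncard, toLex (if IsCompleteScan τ E then 1 else 0, E.rank))

theorem Event.rank_lt_rank {E F : Event n} (h : E.start < F.start) : E.rank < F.rank := by
  cases E <;> cases F <;> simp_all [Event.start, Event.rank] <;> omega

theorem scansBefore_finite (τ : Exec n V) (α : Fin n → Event n → Event n) (E : Event n) :
    (scansBefore τ α E).Finite :=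
  (finite_setOf_isCompleteScan τ).subset fun _ h => h.1

/-- Since the sets are finite, inclusion bounds the first component of the key; if the cardinalities
agree, the scan bit and then the rank decide. -/
theorem linKey_lt_of_subset {α : Fin n → Event n → Event n} {E F : Event n}
    (h : scansBefore τ α E ⊆ scansBefore τ α F) (h' : IsCompleteScan τ E → IsCompleteScan τ F)
    (hr : E.rank < F.rank ∨ ¬ IsCompleteScan τ E ∧ IsCompleteScan τ F) :
    linKey τ α E < linKey τ α F := by
  have hcard := Set.ncard_le_ncard h (scansBefore_finite τ α F)
  simp only [linKey, Prod.Lex.toLex_lt_toLex]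
  rcases hcard.lt_or_eq with h1 | h1
  · exact Or.inl h1
  · refine Or.inr ⟨h1, ?_⟩
    split_ifs <;> simp_all

/-- The rank alone identifies an event: it is below `n` for initial events, and `n` plus the
starting position for all others. -/
theorem linKey_injective (hwf : WellFormed τ) {α : Fin n → Event n → Event n} {i j : Fin n}
    {E F : Event n} (hE : IsEvent τ i E) (hF : IsEvent τ j F)
    (h : linKey τ α E = linKey τ α F) : E = F := by
  have hr : E.rank = F.rank := by
    simp only [linKey] at h
    exact (Prod.mk.inj (toLex.injective (Prod.mk.inj (toLex.injective h)).2)).2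
  rcases Nat.eq_zero_or_pos E.start with h0 | h0
  · cases E with
    | initial k =>
      cases F with
      | initial k' => rw [Fin.ext (show (k : ℕ) = k' from hr)]
      | complete s t => exact absurd (show (k : ℕ) = n + s from hr) (by omega)
      | pending s => exact absurd (show (k : ℕ) = n + s from hr) (by omega)
    | complete s t => simp [Event.start] at h0
    | pending s => simp [Event.start] at h0
  · refine hwf.event_ext hE hF h0 ?_
    rcases lt_trichotomy E.start F.start with h1 | h1 | h1
    · exact absurd hr (Event.rank_lt_rank h1).ne
    · exact h1
    · exact absurd hr (Event.rank_lt_rank h1).ne'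

/-- This makes the order match the assignment. If `S` reads `U` or a later update of `i`, every scan
forced before `U` is also forced before `S`, and a tie is broken by the scan bit. Otherwise `S`
itself is forced before `U`. -/
theorem Consistent.linKey_lt_iff {α : Fin n → Event n → Event n} (h : Consistent τ α)
    {i : Fin n} {U S : Event n} (hU : IsUpdate τ i U) (hS : IsCompleteScan τ S) :
    linKey τ α U < linKey τ α S ↔ U.start ≤ (α i S).start := by
  refine ⟨fun hlt => ?_, fun hle => ?_⟩
  · by_contra hnot
    rw [not_le] at hnot
    -- The inclusion uses that scans are comparable: a scan reading an older update than `S`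
    -- somewhere reads none newer than `S` anywhere. It is strict because `S` is forced before `U`
    -- but not before itself.
    have hss : scansBefore τ α S ⊂ scansBefore τ α U := by
      refine (Set.ssubset_iff_of_subset ?_).2 ⟨S, ⟨hS, Or.inl ⟨i, hU, hnot⟩⟩, ?_⟩
      · rintro S' ⟨hS', ⟨j, hj, -⟩ | ⟨-, j, hj⟩⟩
        · exact absurd hS hj.not_isCompleteScan
        · rcases h.chain hS' hS with h1 | h1
          · exact ⟨hS', Or.inl ⟨i, hU, (h1 i).trans_lt hnot⟩⟩
          · exact absurd (h1 j) (not_le.2 hj)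
      · rintro ⟨-, ⟨j, hj, -⟩ | ⟨-, j, hj⟩⟩
        · exact hj.not_isCompleteScan hS
        · exact lt_irrefl _ hj
    refine lt_asymm hlt ?_
    simp only [linKey, Prod.Lex.toLex_lt_toLex]
    exact Or.inl (Set.ncard_lt_ncard hss (scansBefore_finite τ α U))
  · refine linKey_lt_of_subset ?_ (fun h' => absurd h' hU.not_isCompleteScan)
      (Or.inr ⟨hU.not_isCompleteScan, hS⟩)
    rintro S' ⟨hS', ⟨j, hj, hj'⟩ | ⟨hc, -⟩⟩
    · obtain rfl := hU.1.process_eq hj.1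
      exact ⟨hS', Or.inr ⟨hS, i, hj'.trans_le hle⟩⟩
    · exact absurd hc hU.not_isCompleteScan

/-- Each combination of updates and scans uses one field: `closed` for two updates, `latest` for an
update before a scan, `not_precedes` for a scan before an update, and `mono` for two scans. -/
theorem Consistent.linKey_lt_of_precedes {α : Fin n → Event n → Event n} (h : Consistent τ α)
    (hwf : WellFormed τ)
    (hα : ∀ i S, IsCompleteScan τ S → IsUpdate τ i (α i S)) {E F : Event n}
    (hE : (∃ i, IsUpdate τ i E) ∨ IsCompleteScan τ E)
    (hF : (∃ i, IsUpdate τ i F) ∨ IsCompleteScan τ F) (hEF : Precedes E F) :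
    linKey τ α E < linKey τ α F := by
  rcases hE with ⟨i, hE⟩ | hE <;> rcases hF with ⟨j, hF⟩ | hF
  · refine linKey_lt_of_subset ?_ (fun h' => absurd h' hE.not_isCompleteScan)
      (Or.inl (Event.rank_lt_rank (hEF.start_lt hE.1 hF.1)))
    rintro S ⟨hS, ⟨k, hk, hk'⟩ | ⟨hc, -⟩⟩
    · obtain rfl := hE.1.process_eq hk.1
      exact ⟨hS, Or.inl ⟨j, hF, lt_of_not_ge fun hle =>
        not_le.2 hk' (h.closed hS hE hF hEF hle)⟩⟩
    · exact absurd hc hE.not_isCompleteScan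
  · exact (h.linKey_lt_iff hE hF).2 (h.latest hF hE hEF)
  · refine lt_of_not_ge fun hle => ?_
    rcases hle.lt_or_eq with h1 | h1
    · rw [h.linKey_lt_iff hF hE] at h1
      -- The update `F` starts no later than `α j E`, so the scan `E`, which precedes `F`, would
      -- also precede the update it reads.
      refine h.not_precedes j hE ?_
      rcases h1.lt_or_eq with h2 | h2
      · have h3 := precedes_of_start_lt hF.1 (hα j E hE).1 h2
        clear h1
        generalize α j E = U at *
        cases E <;> cases F <;> cases U <;> simp_all [Precedes, Event.start] <;> omega
      · rwa [← hwf.event_ext_of_process hF.1 (hα j E hE).1 h2]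
    · obtain ⟨⟨k, hk⟩, -⟩ := id hE
      rw [linKey_injective hwf hF.1 hk.1 h1] at hF
      exact hF.not_isCompleteScan hE
  · obtain ⟨⟨i, hi⟩, -⟩ := id hE
    obtain ⟨⟨j, hj⟩, -⟩ := id hF
    refine linKey_lt_of_subset ?_ (fun _ => hF)
      (Or.inl (Event.rank_lt_rank (hEF.start_lt hi.1 hj.1)))
    rintro S ⟨hS, ⟨k, hk, -⟩ | ⟨-, k, hk⟩⟩
    · exact absurd hE hk.not_isCompleteScan
    · exact ⟨hS, Or.inr ⟨hF, k, hk.trans_le (h.mono hE hF hEF k)⟩⟩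

theorem Consistent.linearizable {α : Fin n → Event n → Event n} (h : Consistent τ α)
    (hwf : WellFormed τ) {initVal : Fin n → V}
    (hα : ∀ i S, IsCompleteScan τ S → IsUpdate τ i (α i S))
    (hval : ∀ S, IsCompleteScan τ S → ∃ z, Returns τ S z ∧ ∀ i, HasArg initVal τ (α i S) (z i)) :
    Linearizable initVal τ := by
  have hev : ∀ E, (∃ i, IsUpdate τ i E) ∨ IsCompleteScan τ E → ∃ i, IsEvent τ i E := by
    rintro E (⟨i, hi⟩ | ⟨⟨i, hi⟩, -⟩)
    exacts [⟨i, hi.1⟩, ⟨i, hi.1⟩]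
  -- Pending updates are kept because scans may read them; pending scans are dropped.
  refine ⟨{E | (∃ i, IsUpdate τ i E) ∨ IsCompleteScan τ E},
    fun E F => linKey τ α E < linKey τ α F, fun i E hE hc => ?_, hev, fun E _ => lt_irrefl _,
    fun E _ F _ G _ => lt_trans, fun E hE F hF => ?_,
    fun E hE F hF => h.linKey_lt_of_precedes hwf hα hE hF, fun S hS k hk hc => ?_⟩
  · exact hE.isUpdate_or_isScan.imp (fun h => ⟨i, h⟩) fun h => ⟨⟨i, h⟩, hc⟩
  · obtain ⟨i, hi⟩ := hev E hE
    obtain ⟨j, hj⟩ := hev F hF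
    rcases lt_trichotomy (linKey τ α E) (linKey τ α F) with h1 | h1 | h1
    exacts [Or.inl h1, Or.inr (Or.inl (linKey_injective hwf hi hj h1)), Or.inr (Or.inr h1)]
  · have hcs : IsCompleteScan τ S := ⟨⟨k, hk⟩, hc⟩
    obtain ⟨z, hz, hz'⟩ := hval S hcs
    refine ⟨z, hz, fun i => ⟨α i S, Or.inl ⟨i, hα i S hcs⟩, hα i S hcs,
      (h.linKey_lt_iff (hα i S hcs) hcs).2 le_rfl, fun U _ hU hlt => ?_, hz' i⟩⟩
    rcases ((h.linKey_lt_iff hU hcs).1 hlt).lt_or_eq with h1 | h1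
    · exact Or.inr (h.linKey_lt_of_precedes hwf hα (Or.inl ⟨i, hU⟩) (Or.inl ⟨i, hα i S hcs⟩)
        (precedes_of_start_lt hU.1 (hα i S hcs).1 h1))
    · exact Or.inl (hwf.event_ext_of_process hU.1 (hα i S hcs).1 h1)

end Linearization

/-! ### Changing the arguments of an execution. -/

section Similarity

variable {n : ℕ} {V : Type u}

theorem Similar.refl (τ : Exec n V) : Similar τ τ := ⟨rfl, fun _ => rfl, fun _ => rfl⟩

theorem Similar.snoc {τ τ' : Exec n V} (h : Similar τ τ') (p : Fin n)
    {a a' : Action V (Fin n → V)} (ha : a.startKind = a'.startKind) :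
    Similar (τ ++ [(p, a)]) (τ' ++ [(p, a')]) := by
  obtain ⟨h1, h2, h3⟩ := h
  refine ⟨by simp [h1], fun l => ?_, fun i => ?_⟩
  · rcases lt_or_ge l τ.length with hl | hl
    · rw [List.getElem?_append_left hl, List.getElem?_append_left (h1 ▸ hl), h2]
    · rw [List.getElem?_append_right hl, List.getElem?_append_right (h1 ▸ hl), h1]
      cases l - τ'.length <;> simp
  · have := h3 i
    simp only [opKinds] at this
    simp [opKinds, List.filterMap_append, this, ha, List.filterMap_cons]

namespace Algorithm

variable {A : Algorithm.{u, v, w} n V}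

theorem run_snoc_iff {τ : Exec n V} {p : Fin n} {a : Action V (Fin n → V)} {s' : A.State} :
    A.Run (τ ++ [(p, a)]) s' ↔ ∃ s, A.Run τ s ∧ A.Step s p a s' := by
  refine ⟨fun h => ?_, fun ⟨s, h, h'⟩ => h.snoc h'⟩
  generalize hσ : τ ++ [(p, a)] = σ at h
  cases h with
  | nil => simp at hσ
  | snoc h h' =>
    obtain ⟨rfl, h1⟩ := List.append_inj' hσ rfl
    obtain ⟨rfl, rfl⟩ := Prod.mk.inj (List.cons.inj h1).1
    exact ⟨_, h, h'⟩

/-- Idleness is expressed by events because schedule-basedness transfers events, but not states, to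
similar executions. -/
theorem Run.idle_iff {τ : Exec n V} {s : A.State} (h : A.Run τ s) (i : Fin n) :
    s.1 i = .idle ↔ ∀ l, ¬ IsScan τ i (.pending l) ∧ ¬ IsUpdate τ i (.pending l) := by
  have hst := h.wellFormed_and_statusAgrees.2 i
  generalize s.1 i = c at hst ⊢
  cases c with
  | idle =>
    refine ⟨fun _ l => ?_, fun _ => rfl⟩
    have : ¬ IsEvent τ i (.pending l) := fun h => by
      obtain ⟨t, ht, ht'⟩ := hst l h.1
      exact (h.2 t ht).2 ht'
    exact ⟨fun h => this h.1, fun h => this h.1⟩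
  | scanning c =>
    obtain ⟨l, hl⟩ := hst
    exact ⟨(fun h => nomatch h), fun h => absurd hl (h l).1⟩
  | updating c =>
    obtain ⟨l, hl⟩ := hst
    exact ⟨(fun h => nomatch h), fun h => absurd hl (h l).2⟩

theorem ScheduleBased.isScan_iff (hS : A.ScheduleBased) {τ τ' : Exec n V} (h : A.IsExec τ)
    (h' : A.IsExec τ') (hsim : Similar τ τ') (i : Fin n) (E : Event n) :
    IsScan τ i E ↔ IsScan τ' i E :=
  let ⟨_, _, hα⟩ := hS τ h
  ((hα τ' h' hsim).1 i E).1

theorem ScheduleBased.isUpdate_iff (hS : A.ScheduleBased) {τ τ' : Exec n V} (h : A.IsExec τ)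
    (h' : A.IsExec τ') (hsim : Similar τ τ') (i : Fin n) (E : Event n) :
    IsUpdate τ i E ↔ IsUpdate τ' i E :=
  let ⟨_, _, hα⟩ := hS τ h
  ((hα τ' h' hsim).1 i E).2

theorem ScheduleBased.idle_iff (hS : A.ScheduleBased) {τ τ' : Exec n V} {s s' : A.State}
    (h : A.Run τ s) (h' : A.Run τ' s') (hsim : Similar τ τ') (i : Fin n) :
    s.1 i = .idle ↔ s'.1 i = .idle := by
  rw [h.idle_iff, h'.idle_iff]
  simp only [hS.isScan_iff ⟨s, h⟩ ⟨s', h'⟩ hsim, hS.isUpdate_iff ⟨s, h⟩ ⟨s', h'⟩ hsim]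

theorem LocalStep.startKind_eq_none_iff {i : Fin n} {c c' : A.Local i} {m m' : A.Mem}
    {a : Action V (Fin n → V)} (h : A.LocalStep i c m a c' m') :
    a.startKind = none ↔ c ≠ .idle := by
  cases h <;> simp [Action.startKind]

/-- The arguments of the updates of an execution can be chosen freely. -/
theorem exists_similar_of_args (hS : A.ScheduleBased) (hB : A.ArgumentsDoNotBlock)
    (f : Fin n → ℕ → V) {τ : Exec n V} {s : A.State} (h : A.Run τ s) :
    ∃ τ', A.IsExec τ' ∧ Similar τ τ' ∧
      ∀ l i x, τ'[l]? = some (i, .startUpdate x) → x = f i l := by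
  induction h with
  | nil => exact ⟨[], ⟨_, .nil⟩, Similar.refl _, by simp⟩
  | @snoc τ s p a s₁ hrun hstep ih =>
    obtain ⟨τ', ⟨s', hrun'⟩, hsim, hf⟩ := ih
    suffices hmain : ∃ a', A.IsExec (τ' ++ [(p, a')]) ∧ a.startKind = a'.startKind ∧
        ∀ x, a' = .startUpdate x → x = f p τ'.length by
      obtain ⟨a', h1, h2, h3⟩ := hmain
      refine ⟨_, h1, hsim.snoc p h2, fun l i x hl => ?_⟩
      rcases (getElem?_snoc_eq_some_iff ..).1 hl with hl | ⟨rfl, hl'⟩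
      · exact hf l i x hl
      · obtain ⟨rfl, rfl⟩ := Prod.mk.inj hl'
        exact h3 x rfl
    have hcan := hB τ τ' ⟨s, hrun⟩ ⟨s', hrun'⟩ hsim p ⟨a, s₁, hrun.snoc hstep⟩
    obtain ⟨c, m, hloc, rfl⟩ := hstep
    -- A busy process may take any available step: similarity only constrains the kinds of
    -- operations started, not whether the step is internal or which vector it returns.
    have hother : s.1 p ≠ .idle → ∃ a', A.IsExec (τ' ++ [(p, a')]) ∧ a.startKind = a'.startKind ∧
        ∀ x, a' = .startUpdate x → x = f p τ'.length := fun hne => by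
      obtain ⟨a', s₂, h₂⟩ := hcan
      -- Because of nondeterminism, this run of `τ'` may pass through a state other than `s'`; it is
      -- busy there too, since idleness depends only on the execution.
      obtain ⟨s₃, h₃, c₃, m₃, hloc₃, -⟩ := run_snoc_iff.1 h₂
      have ha' := hloc₃.startKind_eq_none_iff.2 (mt (hS.idle_iff hrun h₃ hsim p).2 hne)
      refine ⟨a', ⟨s₂, h₂⟩, (hloc.startKind_eq_none_iff.2 hne).trans ha'.symm, ?_⟩
      rintro x rfl
      simp [Action.startKind] at ha'
    by_cases hidle : s.1 p = .idle
    swap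
    · exact hother hidle
    have hidle' := (hS.idle_iff hrun hrun' hsim p).1 hidle
    have hk := mt hloc.startKind_eq_none_iff.1 (not_not.2 hidle)
    -- An idle process starts an operation of the kind that `a` starts. Totality of the start
    -- relations makes this possible with the prescribed argument.
    cases a with
    | startScan =>
      obtain ⟨c', m', hs⟩ := A.scanStart_total p s'.2
      have hloc' : A.LocalStep p (s'.1 p) s'.2 .startScan (.scanning c') m' := by
        rw [hidle']
        exact .scanStart hs
      exact ⟨.startScan, ⟨_, hrun'.snoc ⟨_, m', hloc', rfl⟩⟩, rfl, by simp⟩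
    | startUpdate x =>
      obtain ⟨c', m', hs⟩ := A.updStart_total p (f p τ'.length) s'.2
      have hloc' : A.LocalStep p (s'.1 p) s'.2 (.startUpdate (f p τ'.length)) (.updating c') m' := by
        rw [hidle']
        exact .updStart hs
      exact ⟨.startUpdate (f p τ'.length), ⟨_, hrun'.snoc ⟨_, m', hloc', rfl⟩⟩, rfl, by simp⟩
    | _ => exact absurd rfl hk

end Algorithm

end Similarity

/-! ### The monitor and its alphabet. -/

namespace Action

variable {V : Type u} {R : Type v}

/-- The argument of the update that starts with the action. -/
def arg? : Action V R → Option V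
  | startUpdate x => some x
  | _ => none

/-- The vector returned by the scan that ends with the action. -/
def result? : Action V R → Option R
  | endScan r => some r
  | _ => none

/-- Boolean test for the first action of a scan. -/
def startsScan : Action V R → Bool
  | startScan => true
  | _ => false

/-- Boolean test for the last action of an operation. -/
def ends : Action V R → Bool
  | endScan _ => true
  | endUpdate => true
  | _ => false

theorem arg?_eq_some {a : Action V R} {x : V} : a.arg? = some x ↔ a = startUpdate x := by
  cases a <;> simp [arg?]

theorem result?_eq_some {a : Action V R} {r : R} : a.result? = some r ↔ a = endScan r := by
  cases a <;> simp [result?]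

theorem startsScan_eq_true {a : Action V R} : a.startsScan = true ↔ a = startScan := by
  cases a <;> simp [startsScan]

theorem ends_eq_true {a : Action V R} : a.ends = true ↔ a.IsEnd := by
  cases a <;> simp [ends, IsEnd]

end Action

/-- What a monitor for the processes `i`, `j` and `k` sees of an action, when one update argument of
`i` and one of `j` are called high and all others low. -/
@[ext]
structure Letter where
  /-- process `i` starts a high update -/
  highI : Bool
  /-- process `i` starts a low update -/
  lowI : Bool
  /-- process `i` ends an operation -/
  endI : Bool
  /-- process `j` starts a high update -/
  highJ : Bool
  /-- process `j` starts a low update -/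
  lowJ : Bool
  /-- process `k` starts a scan -/
  scanK : Bool
  /-- the action is by process `k` -/
  byK : Bool
  /-- a scan ends -/
  ret : Bool
  /-- a scan ends with a high entry of process `i` -/
  retHighI : Bool
  /-- a scan ends with a high entry of process `j` -/
  retHighJ : Bool

/-- The letter seen when process `p` performs the action `a`. -/
def observe {P : Type*} {V : Type u} {R : Type v} [DecidableEq P] [DecidableEq V] (i j k : P)
    (bi bj : V) (zi zj : R → V) (e : P × Action V R) : Letter where
  highI := decide (e.1 = i) && decide (e.2.arg? = some bi)
  lowI := decide (e.1 = i) && !decide (e.2.arg? = none) && !decide (e.2.arg? = some bi)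
  endI := decide (e.1 = i) && e.2.ends
  highJ := decide (e.1 = j) && decide (e.2.arg? = some bj)
  lowJ := decide (e.1 = j) && !decide (e.2.arg? = none) && !decide (e.2.arg? = some bj)
  scanK := decide (e.1 = k) && e.2.startsScan
  byK := decide (e.1 = k)
  ret := !decide ((e.2.result?.map zi) = none)
  retHighI := decide (e.2.result?.map zi = some bi)
  retHighJ := decide (e.2.result?.map zj = some bj)

/-- A monitor that looks for a violation of linearizability in executions in which the processes
`i` and `j` only write low values first, and then only high values. -/
@[ext]
structure Monitor where
  /-- a high update of `i` has started -/
  highI : Bool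
  /-- a high update of `i` has ended -/
  doneI : Bool
  /-- a high update of `j` has started -/
  highJ : Bool
  /-- a low update of `i` or `j` has started after a high one -/
  dead : Bool
  /-- a high update of `i` ended before the first high update of `j` started -/
  ordered : Bool
  /-- a scan returned a low entry of `i` and a high entry of `j` -/
  lowHigh : Bool
  /-- a scan returned a high entry of `i` and a low entry of `j` -/
  highLow : Bool
  /-- a scan returned a high entry of `i` -/
  high : Bool
  /-- process `k` has started a scan that has to return a high entry of `i` -/
  armed : Bool
  /-- a scan returned a high entry of `i` before any high update of `i` started -/
  early : Bool
  /-- a scan of `k` that had to return a high entry of `i` returned a low one -/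
  stale : Bool

namespace Monitor

/-- The initial state of the monitor. -/
def init : Monitor :=
  ⟨false, false, false, false, false, false, false, false, false, false, false⟩

/-- The transition function of the monitor. -/
def step (m : Monitor) (c : Letter) : Monitor where
  highI := m.highI || c.highI
  doneI := m.doneI || (c.endI && m.highI)
  highJ := m.highJ || c.highJ
  dead := m.dead || (c.lowI && m.highI || c.lowJ && m.highJ)
  ordered := m.ordered || (c.highJ && !m.highJ && m.doneI)
  lowHigh := m.lowHigh || (c.ret && !c.retHighI && c.retHighJ)
  highLow := m.highLow || (c.retHighI && !c.retHighJ)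
  high := m.high || c.retHighI
  armed := m.armed || (c.scanK && (m.doneI || m.high))
  early := m.early || (c.retHighI && !m.highI)
  stale := m.stale || (c.byK && c.ret && !c.retHighI && m.armed)

/-- The monitor has seen a violation of linearizability. -/
def accepts (m : Monitor) : Bool :=
  !m.dead && (m.early || m.stale || m.lowHigh && (m.highLow || m.ordered))

/-- A flag that is never reset is set iff it has been set at some position. -/
theorem latch_iff {α M : Type*} (f : M → Bool) (g : M → α → M) (c : M → α → Bool) (m₀ : M)
    (h₀ : f m₀ = false) (h : ∀ m a, f (g m a) = (f m || c m a)) (τ : List α) :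
    f (τ.foldl g m₀) = true ↔
      ∃ l e, τ[l]? = some e ∧ c ((τ.take l).foldl g m₀) e = true := by
  induction τ using List.reverseRecOn with
  | nil => simp [h₀]
  | append_singleton τ a ih =>
    rw [List.foldl_append]
    simp only [List.foldl_cons, List.foldl_nil, h, Bool.or_eq_true, ih, getElem?_snoc_eq_some_iff]
    constructor
    · rintro (⟨l, e, hl, hc⟩ | hc)
      · refine ⟨l, e, Or.inl hl, ?_⟩
        rwa [List.take_append_of_le_length (lt_length_of_getElem?_eq_some hl).le]
      · exact ⟨τ.length, a, Or.inr ⟨rfl, rfl⟩, by simpa using hc⟩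
    · rintro ⟨l, e, hl | ⟨rfl, rfl⟩, hc⟩
      · rw [List.take_append_of_le_length (lt_length_of_getElem?_eq_some hl).le] at hc
        exact Or.inl ⟨l, e, hl, hc⟩
      · exact Or.inr (by simpa using hc)

end Monitor

/-! ### The meaning of the monitor flags. -/

section Semantics

variable {n : ℕ} {V : Type u}

/-- Process `i` starts an update with argument `b i` at position `l`. -/
def HighAt (b : Fin n → V) (τ : Exec n V) (i : Fin n) (l : ℕ) : Prop :=
  τ[l]? = some (i, .startUpdate (b i))

/-- Process `i` never starts an update with another argument than `b i` after one with that
argument. -/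
def IsThreshold (b : Fin n → V) (τ : Exec n V) (i : Fin n) : Prop :=
  ∀ l l' x, HighAt b τ i l → l < l' → τ[l']? = some (i, .startUpdate x) → x = b i

/-- A high update of process `i` is over before position `t`. -/
def DoneBefore (b : Fin n → V) (τ : Exec n V) (i : Fin n) (t : ℕ) : Prop :=
  ∃ l l', l < l' ∧ l' < t ∧ HighAt b τ i l ∧ IsLast τ i l'

/-- A scan ends at position `t` and returns `z`. -/
def ReturnsAt (τ : Exec n V) (t : ℕ) (z : Fin n → V) : Prop :=
  ∃ p, τ[t]? = some (p, .endScan z)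

/-- At position `l`, process `k` starts a scan that has to return a high entry of `i`. -/
def ArmedAt (b : Fin n → V) (τ : Exec n V) (i k : Fin n) (l : ℕ) : Prop :=
  τ[l]? = some (k, .startScan) ∧
    (DoneBefore b τ i l ∨ ∃ t < l, ∃ z, ReturnsAt τ t z ∧ z i = b i)

/-- There is a violation of linearizability that involves scans of high and low entries of the
processes `i` and `j`, and scans of process `k`. -/
def Violation (b : Fin n → V) (τ : Exec n V) (i j k : Fin n) : Prop :=
  (∃ t z, ReturnsAt τ t z ∧ z i = b i ∧ ∀ l < t, ¬ HighAt b τ i l) ∨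
  (∃ l t z, l < t ∧ ArmedAt b τ i k l ∧ τ[t]? = some (k, .endScan z) ∧ z i ≠ b i) ∨
  ((∃ t z, ReturnsAt τ t z ∧ z i ≠ b i ∧ z j = b j) ∧
    ((∃ t z, ReturnsAt τ t z ∧ z i = b i ∧ z j ≠ b j) ∨
      ∃ l, HighAt b τ j l ∧ (∀ l' < l, ¬ HighAt b τ j l') ∧ DoneBefore b τ i l))

open Classical in
/-- The letter seen by the monitor in an execution. -/
noncomputable def execLetter (b : Fin n → V) (i j k : Fin n)
    (e : Fin n × Action V (Fin n → V)) : Letter :=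
  observe i j k (b i) (b j) (fun z => z i) (fun z => z j) e

/-- The state of the monitor after an execution. -/
noncomputable def execMonitor (b : Fin n → V) (i j k : Fin n) (τ : Exec n V) : Monitor :=
  τ.foldl (fun m e => m.step (execLetter b i j k e)) Monitor.init

variable {b : Fin n → V} {i j k : Fin n} {τ : Exec n V}

/-- The flags are latches, so each can be interpreted separately: it is set iff its triggering
condition held at some position, with the other flags evaluated on the prefix before it. This is why
meanings on prefixes `τ.take l` are needed. -/
theorem execMonitor_latch_iff (f : Monitor → Bool) (c : Monitor → Letter → Bool)
    (h₀ : f .init = false) (h : ∀ m a, f (m.step a) = (f m || c m a)) (τ : Exec n V) :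
    f (execMonitor b i j k τ) = true ↔ ∃ l e, τ[l]? = some e ∧
      c (execMonitor b i j k (τ.take l)) (execLetter b i j k e) = true :=
  Monitor.latch_iff f _ (fun m e => c m (execLetter b i j k e)) _ h₀ (fun _ _ => h _ _) τ

theorem getElem?_take_eq_some_iff {α : Type*} {τ : List α} {l l' : ℕ} {e : α} :
    (τ.take l)[l']? = some e ↔ l' < l ∧ τ[l']? = some e := by
  rw [List.getElem?_take]
  split_ifs with h <;> simp [h]

theorem highAt_take {l l' : ℕ} : HighAt b (τ.take l) i l' ↔ l' < l ∧ HighAt b τ i l' :=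
  getElem?_take_eq_some_iff

theorem isLast_take {l l' : ℕ} : IsLast (τ.take l) i l' ↔ l' < l ∧ IsLast τ i l' := by
  simp only [IsLast, getElem?_take_eq_some_iff]
  grind

theorem returnsAt_take {l t : ℕ} {z : Fin n → V} :
    ReturnsAt (τ.take l) t z ↔ t < l ∧ ReturnsAt τ t z := by
  simp only [ReturnsAt, getElem?_take_eq_some_iff, exists_and_left]

theorem execMonitor_highI (τ : Exec n V) :
    (execMonitor b i j k τ).highI = true ↔ ∃ l, HighAt b τ i l := by
  rw [execMonitor_latch_iff Monitor.highI (fun _ c => c.highI) rfl (fun _ _ => rfl)]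
  simp [execLetter, observe, HighAt, Action.arg?_eq_some]

theorem execMonitor_highJ (τ : Exec n V) :
    (execMonitor b i j k τ).highJ = true ↔ ∃ l, HighAt b τ j l := by
  rw [execMonitor_latch_iff Monitor.highJ (fun _ c => c.highJ) rfl (fun _ _ => rfl)]
  simp [execLetter, observe, HighAt, Action.arg?_eq_some]

theorem execMonitor_doneI (τ : Exec n V) :
    (execMonitor b i j k τ).doneI = true ↔ ∃ t, DoneBefore b τ i t := by
  rw [execMonitor_latch_iff Monitor.doneI (fun m c => c.endI && m.highI) rfl (fun _ _ => rfl)]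
  simp only [execMonitor_highI, highAt_take, Bool.and_eq_true]
  simp only [execLetter, observe, decide_eq_true_eq, Bool.and_eq_true, Action.ends_eq_true]
  constructor
  · rintro ⟨l, ⟨p, a⟩, he, ⟨rfl, ha⟩, l', hl', hl⟩
    exact ⟨l + 1, l', l, hl', l.lt_succ_self, hl, a, he, ha⟩
  · rintro ⟨t, l, l', h1, h2, h3, a, ha, ha'⟩
    exact ⟨l', (i, a), ha, ⟨rfl, ha'⟩, l, h1, h3⟩

theorem execMonitor_doneI_take (l : ℕ) :
    (execMonitor b i j k (τ.take l)).doneI = true ↔ DoneBefore b τ i l := by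
  rw [execMonitor_doneI]
  simp only [DoneBefore, highAt_take, isLast_take]
  exact ⟨fun ⟨t, l₁, l₂, h1, h2, h3, h4⟩ => ⟨l₁, l₂, h1, h4.1, h3.2, h4.2⟩,
    fun ⟨l₁, l₂, h1, h2, h3, h4⟩ => ⟨l, l₁, l₂, h1, h2, ⟨h1.trans h2, h3⟩, h2, h4⟩⟩

theorem execMonitor_dead (τ : Exec n V) :
    (execMonitor b i j k τ).dead = false ↔ IsThreshold b τ i ∧ IsThreshold b τ j := by
  rw [← not_iff_not, Bool.not_eq_false, execMonitor_latch_iff Monitor.dead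
    (fun m c => c.lowI && m.highI || c.lowJ && m.highJ) rfl (fun _ _ => rfl)]
  simp only [Bool.and_eq_true, Bool.or_eq_true, execMonitor_highI, execMonitor_highJ,
    highAt_take, not_and_or]
  have key : ∀ (q : Fin n) (e : Fin n × Action V (Fin n → V)),
      ((e.1 = q ∧ ¬ e.2.arg? = none) ∧ ¬ e.2.arg? = some (b q)) ↔
        ∃ x, e = (q, .startUpdate x) ∧ x ≠ b q := by
    rintro q ⟨p, a⟩
    cases a <;> simp [Action.arg?]
  simp only [execLetter, observe, Bool.and_eq_true, Bool.not_eq_true', decide_eq_false_iff_not,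
    decide_eq_true_eq, key, IsThreshold]
  grind

theorem execMonitor_ordered (τ : Exec n V) :
    (execMonitor b i j k τ).ordered = true ↔
      ∃ l, HighAt b τ j l ∧ (∀ l' < l, ¬ HighAt b τ j l') ∧ DoneBefore b τ i l := by
  rw [execMonitor_latch_iff Monitor.ordered (fun m c => c.highJ && !m.highJ && m.doneI) rfl
    (fun _ _ => rfl)]
  simp only [Bool.and_eq_true, Bool.not_eq_true', ← Bool.not_eq_true, execMonitor_doneI_take,
    execMonitor_highJ, highAt_take]
  simp [execLetter, observe, Action.arg?_eq_some]
  simp only [HighAt]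

theorem map_result?_eq_some {a : Action V (Fin n → V)} {x : V} :
    a.result?.map (fun z => z i) = some x ↔ ∃ z, a = .endScan z ∧ z i = x := by
  cases a <;> simp [Action.result?]

theorem map_result?_ne_none {a : Action V (Fin n → V)} :
    ¬ a.result?.map (fun z => z i) = none ↔ ∃ z, a = .endScan z := by
  cases a <;> simp [Action.result?]

theorem execMonitor_lowHigh (τ : Exec n V) :
    (execMonitor b i j k τ).lowHigh = true ↔
      ∃ t z, ReturnsAt τ t z ∧ z i ≠ b i ∧ z j = b j := by
  rw [execMonitor_latch_iff Monitor.lowHigh (fun _ c => c.ret && !c.retHighI && c.retHighJ) rfl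
    (fun _ _ => rfl)]
  simp only [execLetter, observe, Bool.and_eq_true, Bool.not_eq_true', decide_eq_false_iff_not,
    decide_eq_true_eq, map_result?_eq_some, map_result?_ne_none, ReturnsAt]
  grind

theorem execMonitor_highLow (τ : Exec n V) :
    (execMonitor b i j k τ).highLow = true ↔
      ∃ t z, ReturnsAt τ t z ∧ z i = b i ∧ z j ≠ b j := by
  rw [execMonitor_latch_iff Monitor.highLow (fun _ c => c.retHighI && !c.retHighJ) rfl
    (fun _ _ => rfl)]
  simp only [execLetter, observe, Bool.and_eq_true, Bool.not_eq_true', decide_eq_false_iff_not,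
    decide_eq_true_eq, map_result?_eq_some, ReturnsAt]
  grind

theorem execMonitor_high (τ : Exec n V) :
    (execMonitor b i j k τ).high = true ↔
      ∃ t z, ReturnsAt τ t z ∧ z i = b i := by
  rw [execMonitor_latch_iff Monitor.high (fun _ c => c.retHighI) rfl (fun _ _ => rfl)]
  simp only [execLetter, observe, decide_eq_true_eq, map_result?_eq_some, ReturnsAt]
  grind

theorem execMonitor_armed (τ : Exec n V) :
    (execMonitor b i j k τ).armed = true ↔ ∃ l, ArmedAt b τ i k l := by
  rw [execMonitor_latch_iff Monitor.armed (fun m c => c.scanK && (m.doneI || m.high)) rfl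
    (fun _ _ => rfl)]
  simp only [Bool.and_eq_true, Bool.or_eq_true, execMonitor_doneI_take, execMonitor_high,
    returnsAt_take, ArmedAt, execLetter, observe, decide_eq_true_eq, Action.startsScan_eq_true]
  constructor
  · rintro ⟨l, ⟨p, a⟩, he, ⟨rfl, rfl⟩, h⟩
    exact ⟨l, he, h.imp_right fun ⟨t, z, h, h'⟩ => ⟨t, h.1, z, h.2, h'⟩⟩
  · rintro ⟨l, he, h⟩
    exact ⟨l, _, he, ⟨rfl, rfl⟩, h.imp_right fun ⟨t, h, z, h', h''⟩ => ⟨t, z, ⟨h, h'⟩, h''⟩⟩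

theorem execMonitor_armed_take (t : ℕ) :
    (execMonitor b i j k (τ.take t)).armed = true ↔ ∃ l < t, ArmedAt b τ i k l := by
  rw [execMonitor_armed]
  simp only [ArmedAt, getElem?_take_eq_some_iff, DoneBefore, highAt_take, isLast_take,
    returnsAt_take]
  constructor
  · rintro ⟨l, ⟨h0, h1⟩, ⟨l₁, l₂, h2, h3, h4, h5⟩ | ⟨t', h2, z, h3, h4⟩⟩
    · exact ⟨l, h0, h1, Or.inl ⟨l₁, l₂, h2, h3, h4.2, h5.2⟩⟩
    · exact ⟨l, h0, h1, Or.inr ⟨t', h2, z, h3.2, h4⟩⟩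
  · rintro ⟨l, h0, h1, ⟨l₁, l₂, h2, h3, h4, h5⟩ | ⟨t', h2, z, h3, h4⟩⟩
    · exact ⟨l, ⟨h0, h1⟩, Or.inl ⟨l₁, l₂, h2, h3, ⟨(h2.trans h3).trans h0, h4⟩, h3.trans h0, h5⟩⟩
    · exact ⟨l, ⟨h0, h1⟩, Or.inr ⟨t', h2, z, ⟨h2.trans h0, h3⟩, h4⟩⟩

theorem execMonitor_early (τ : Exec n V) :
    (execMonitor b i j k τ).early = true ↔
      ∃ t z, ReturnsAt τ t z ∧ z i = b i ∧ ∀ l < t, ¬ HighAt b τ i l := by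
  rw [execMonitor_latch_iff Monitor.early (fun m c => c.retHighI && !m.highI) rfl
    (fun _ _ => rfl)]
  simp only [Bool.and_eq_true, Bool.not_eq_true', ← Bool.not_eq_true, execMonitor_highI,
    highAt_take]
  simp only [execLetter, observe, decide_eq_true_eq, map_result?_eq_some, ReturnsAt]
  grind

theorem execMonitor_stale (τ : Exec n V) :
    (execMonitor b i j k τ).stale = true ↔
      ∃ l t z, l < t ∧ ArmedAt b τ i k l ∧ τ[t]? = some (k, .endScan z) ∧ z i ≠ b i := by
  rw [execMonitor_latch_iff Monitor.stale (fun m c => c.byK && c.ret && !c.retHighI && m.armed) rfl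
    (fun _ _ => rfl)]
  simp only [Bool.and_eq_true, execMonitor_armed_take]
  simp only [execLetter, observe, Bool.not_eq_true', decide_eq_false_iff_not,
    decide_eq_true_eq, map_result?_eq_some, map_result?_ne_none]
  grind

theorem execMonitor_accepts (τ : Exec n V) :
    (execMonitor b i j k τ).accepts = true ↔
      (IsThreshold b τ i ∧ IsThreshold b τ j) ∧ Violation b τ i j k := by
  simp only [Monitor.accepts, Bool.and_eq_true, Bool.or_eq_true, Bool.not_eq_true',
    execMonitor_dead, execMonitor_early, execMonitor_stale, execMonitor_lowHigh,
    execMonitor_highLow, execMonitor_ordered, Violation, or_assoc]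

end Semantics

/-! ### Violations exclude linearizations. -/

section Soundness

variable {n : ℕ} {V : Type u}

/-- `r` is a linearization of `τ` with set of events `H`. -/
structure IsLinearization (initVal : Fin n → V) (τ : Exec n V) (H : Set (Event n))
    (r : Event n → Event n → Prop) : Prop where
  mem : ∀ i E, IsEvent τ i E → E.IsComplete → E ∈ H
  irrefl : ∀ E ∈ H, ¬ r E E
  trans : ∀ E ∈ H, ∀ F ∈ H, ∀ G ∈ H, r E F → r F G → r E G
  total : ∀ E ∈ H, ∀ F ∈ H, r E F ∨ E = F ∨ r F E
  precedes : ∀ E ∈ H, ∀ F ∈ H, Precedes E F → r E F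
  scan : ∀ S ∈ H, ∀ k, IsScan τ k S → S.IsComplete →
      ∃ z, Returns τ S z ∧
        ∀ i, ∃ U ∈ H, IsUpdate τ i U ∧ r U S ∧
          (∀ U' ∈ H, IsUpdate τ i U' → r U' S → U' = U ∨ r U' U) ∧
          HasArg initVal τ U (z i)

theorem Linearizable.exists_isLinearization {initVal : Fin n → V} {τ : Exec n V}
    (h : Linearizable initVal τ) : ∃ H r, IsLinearization initVal τ H r :=
  let ⟨H, r, h1, _, h3, h4, h5, h6, h7⟩ := h
  ⟨H, r, h1, h3, h4, h5, h6, h7⟩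

/-- `U` is an update event of `i` that starts at position `l` and has argument `b i`. -/
def IsHighUpdate (b : Fin n → V) (τ : Exec n V) (i : Fin n) (l : ℕ) (U : Event n) : Prop :=
  IsUpdate τ i U ∧ U.start = l + 1 ∧ HighAt b τ i l

variable {initVal : Fin n → V} {τ : Exec n V} {b : Fin n → V} {H : Set (Event n)}
  {r : Event n → Event n → Prop}

theorem IsUpdate.hasArg_iff_of_start {i : Fin n} {U : Event n} (hU : IsUpdate τ i U) {l : ℕ}
    (hl : U.start = l + 1) {x : V} :
    HasArg initVal τ U x ↔ τ[l]? = some (i, .startUpdate x) := by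
  have key : ∀ y, τ[l]? = some (i, .startUpdate y) →
      ((∃ j, τ[l]? = some (j, .startUpdate x)) ↔ τ[l]? = some (i, .startUpdate x)) :=
    fun y hy => ⟨fun ⟨j, hj⟩ => by
      rw [hj] at hy
      obtain rfl := (Prod.mk.inj (Option.some.inj hy)).1
      exact hj, fun h => ⟨i, h⟩⟩
  cases U with
  | initial j => simp [Event.start] at hl
  | complete s t =>
    obtain rfl : s = l := by simpa [Event.start] using hl
    obtain ⟨y, hy⟩ := hU.2
    exact key y hy
  | pending s =>
    obtain rfl : s = l := by simpa [Event.start] using hl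
    obtain ⟨y, hy⟩ := hU.2
    exact key y hy

theorem IsUpdate.eq_initial {i : Fin n} {U : Event n} (hU : IsUpdate τ i U) (h : U.start = 0) :
    U = .initial i := by
  cases U with
  | initial j => exact congrArg _ hU.1
  | complete s t => simp [Event.start] at h
  | pending s => simp [Event.start] at h

theorem WellFormed.exists_scan (hwf : WellFormed τ) {t : ℕ} {p : Fin n} {z : Fin n → V}
    (ht : τ[t]? = some (p, .endScan z)) :
    ∃ s, IsScan τ p (.complete s t) ∧ QuietBetween τ p s t := by
  obtain ⟨s, hst, hs, hq⟩ := hwf.exists_startScan ht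
  exact ⟨s, ⟨⟨hst, isFirst_of_startScan hs, isLast_of_endScan ht, fun l h h' => (hq l h h').1⟩,
    hs⟩, hq⟩

/-- The last action in `DoneBefore` need not end the high update itself, but the update ends no
later than it. -/
theorem WellFormed.exists_highUpdate (hwf : WellFormed τ) {i : Fin n} {t : ℕ}
    (h : DoneBefore b τ i t) : ∃ l t', t' < t ∧ IsHighUpdate b τ i l (.complete l t') := by
  obtain ⟨l, t', h1, h2, h3, h4⟩ := h
  rcases hwf.exists_event (isFirst_of_startUpdate h3) with ⟨t₀, h5, h6⟩ | h5
  · exact ⟨l, t₀, (h6 t' h1 h4).trans_lt h2, ⟨h5, b i, h3⟩, rfl, h3⟩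
  · exact absurd h4 (h5.2 t' h1).2

theorem IsLinearization.asymm (h : IsLinearization initVal τ H r) {E F : Event n} (hE : E ∈ H)
    (hF : F ∈ H) (hEF : r E F) : ¬ r F E :=
  fun hFE => h.irrefl E hE (h.trans E hE F hF E hE hEF hFE)

/-- A scan that returns a high entry comes after a high update, and before all high updates if it
returns a low entry. -/
theorem IsLinearization.scan_spec (h : IsLinearization initVal τ H r)
    (hb : ∀ i, initVal i ≠ b i) {s t : ℕ} {p : Fin n} {z : Fin n → V}
    (hS : IsScan τ p (.complete s t)) (ht : ReturnsAt τ t z) (i : Fin n) :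
    (z i = b i → ∃ l U, U ∈ H ∧ IsHighUpdate b τ i l U ∧ r U (.complete s t)) ∧
      (z i ≠ b i → IsThreshold b τ i → ∀ l U, U ∈ H → IsHighUpdate b τ i l U →
        r (.complete s t) U) := by
  have hSH := h.mem p _ hS.1 trivial
  obtain ⟨z', ⟨q, hz'⟩, hz⟩ := h.scan _ hSH p hS trivial
  obtain ⟨p', ht⟩ := ht
  rw [ht] at hz'
  obtain ⟨-, hz''⟩ := Prod.mk.inj (Option.some.inj hz')
  obtain rfl := Action.endScan.inj hz''
  obtain ⟨U, hUH, hU, hUS, hlast, harg⟩ := hz i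
  refine ⟨fun hzi => ?_, fun hzi hthr l U' hU'H hU' => ?_⟩
  -- The scan cannot read the initial update, whose value is not high.
  · rcases Nat.eq_zero_or_pos U.start with h0 | h0
    · rw [hU.eq_initial h0] at harg
      exact absurd (harg.symm.trans hzi) (hb i)
    · obtain ⟨l, hl⟩ := Nat.exists_eq_succ_of_ne_zero h0.ne'
      refine ⟨l, U, hUH, ⟨hU, hl, ?_⟩, hUS⟩
      rw [HighAt, ← hzi]
      exact (hU.hasArg_iff_of_start hl).1 harg
  -- The update `U` read by the scan is low, so by the threshold property it starts before the high
  -- update `U'`. If `U'` came before the scan, `U` would not be the last update of `i` before it.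
  · have hlt : U.start < U'.start := by
      rcases Nat.eq_zero_or_pos U.start with h0 | h0
      · rw [h0, hU'.2.1]
        omega
      · obtain ⟨l₁, hl₁⟩ := Nat.exists_eq_succ_of_ne_zero h0.ne'
        have harg' := (hU.hasArg_iff_of_start hl₁).1 harg
        rw [hl₁, hU'.2.1]
        refine Nat.succ_lt_succ (lt_of_not_ge fun hle => ?_)
        rcases hle.lt_or_eq with hlt | rfl
        · exact hzi (hthr l l₁ _ hU'.2.2 hlt harg')
        · have := hU'.2.2
          rw [HighAt, harg'] at this
          exact hzi (Action.startUpdate.inj (Prod.mk.inj (Option.some.inj this)).2)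
    have hUU' := h.precedes U hUH U' hU'H (precedes_of_start_lt hU.1 hU'.1.1 hlt)
    rcases h.total _ hSH U' hU'H with h1 | rfl | h1
    · exact h1
    · exact absurd hS hU'.1.not_isScan
    · rcases hlast U' hU'H hU'.1 h1 with rfl | h2
      · exact absurd hlt (lt_irrefl _)
      · exact absurd h2 (h.asymm hUH hU'H hUU')

/-- A scan follows some high update of each process whose entry is high, and comes before all
linearized high updates of each process whose entry is low. An early high entry contradicts
precedence. An armed scan follows a high update of `i`, directly or through an earlier scan, and so
cannot return a low entry. A low-high scan follows a high update of `j` and comes before all those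
of `i`. This closes a cycle either with a high-low scan or with a high update of `i` that ended
before the first one of `j` started. -/
theorem Violation.not_linearizable {i j k : Fin n} (hv : Violation b τ i j k)
    (hwf : WellFormed τ) (hb : ∀ i, initVal i ≠ b i) (hi : IsThreshold b τ i)
    (hj : IsThreshold b τ j) : ¬ Linearizable initVal τ := by
  intro hlin
  obtain ⟨H, r, h⟩ := hlin.exists_isLinearization
  have hspec := fun {s t p z} => h.scan_spec hb (s := s) (t := t) (p := p) (z := z)
  rcases hv with ⟨t, z, ⟨p, ht⟩, hz, hno⟩ | ⟨l, t, z, hlt, ⟨hl, harm⟩, ht, hz⟩ |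
    ⟨⟨t, z, ⟨p, ht⟩, hzi, hzj⟩, hv⟩
  · obtain ⟨s, hS, -⟩ := hwf.exists_scan ht
    have hSH := h.mem p _ hS.1 trivial
    obtain ⟨l, U, hUH, hU, hUS⟩ := (hspec hS ⟨p, ht⟩ i).1 hz
    have htl : t < l := by
      rcases lt_trichotomy t l with h1 | rfl | h1
      · exact h1
      · exact absurd (isLast_of_endScan ht) (isFirst_of_startUpdate hU.2.2).not_isLast
      · exact absurd hU.2.2 (hno l h1)
    refine h.asymm hUH hSH hUS (h.precedes _ hSH U hUH ?_)
    have := hU.2.1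
    cases U <;> simp_all [Event.start, Precedes]
  · obtain ⟨s, hS, hq⟩ := hwf.exists_scan ht
    have hSH := h.mem k _ hS.1 trivial
    -- The scan that ends at `t` may be a later scan of `k` than the one armed at `l`; it only
    -- starts no earlier.
    have hls : l ≤ s := le_of_not_gt fun h1 => (hq l h1 hlt).1 (isFirst_of_startScan hl)
    rcases harm with hdone | ⟨t₁, ht₁, z₁, ⟨p, hz₁⟩, hz₁'⟩
    · obtain ⟨l₁, t₁, ht₁, hU⟩ := hwf.exists_highUpdate hdone
      have hUH := h.mem i _ hU.1.1 trivial
      exact h.asymm hUH hSH (h.precedes _ hUH _ hSH (ht₁.trans_le hls))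
        ((hspec hS ⟨k, ht⟩ i).2 hz hi _ _ hUH hU)
    · obtain ⟨s₁, hS₁, -⟩ := hwf.exists_scan hz₁
      have hS₁H := h.mem p _ hS₁.1 trivial
      obtain ⟨l₁, U, hUH, hU, hUS₁⟩ := (hspec hS₁ ⟨p, hz₁⟩ i).1 hz₁'
      exact h.asymm hUH hSH (h.trans U hUH _ hS₁H _ hSH hUS₁
        (h.precedes _ hS₁H _ hSH (ht₁.trans_le hls))) ((hspec hS ⟨k, ht⟩ i).2 hz hi _ _ hUH hU)
  · obtain ⟨s, hS, -⟩ := hwf.exists_scan ht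
    have hSH := h.mem p _ hS.1 trivial
    obtain ⟨l, U, hUH, hU, hUS⟩ := (hspec hS ⟨p, ht⟩ j).1 hzj
    rcases hv with ⟨t₁, z₁, ⟨p₁, ht₁⟩, hz₁i, hz₁j⟩ | ⟨l₁, hl₁, hfirst, hdone⟩
    · obtain ⟨s₁, hS₁, -⟩ := hwf.exists_scan ht₁
      have hS₁H := h.mem p₁ _ hS₁.1 trivial
      obtain ⟨l₁, U₁, hU₁H, hU₁, hU₁S₁⟩ := (hspec hS₁ ⟨p₁, ht₁⟩ i).1 hz₁i
      exact h.asymm hSH hS₁H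
        (h.trans _ hSH U₁ hU₁H _ hS₁H ((hspec hS ⟨p, ht⟩ i).2 hzi hi _ _ hU₁H hU₁) hU₁S₁)
        (h.trans _ hS₁H U hUH _ hSH ((hspec hS₁ ⟨p₁, ht₁⟩ j).2 hz₁j hj _ _ hUH hU) hUS)
    · obtain ⟨l₂, t₂, ht₂, hU₂⟩ := hwf.exists_highUpdate hdone
      have hU₂H := h.mem i _ hU₂.1.1 trivial
      have hl : l₁ ≤ l := le_of_not_gt fun h1 => hfirst l h1 hU.2.2
      have hprec : Precedes (.complete l₂ t₂) U := by
        have := hU.2.1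
        cases U <;> simp_all [Event.start, Precedes]
        all_goals omega
      exact h.asymm hU₂H hSH (h.trans _ hU₂H U hUH _ hSH (h.precedes _ hU₂H U hUH hprec) hUS)
        ((hspec hS ⟨p, ht⟩ i).2 hzi hi _ _ hU₂H hU₂)

end Soundness

/-! ### Binary threshold executions suffice. -/

namespace Algorithm

variable {n : ℕ} {V : Type u} {A : Algorithm.{u, v, w} n V}

open Classical in
/-- The one of the two values `x₀` and `x₁` that counts as high in updates of process `i`; it is not
the initial value of `i`. -/
noncomputable def highValue (A : Algorithm.{u, v, w} n V) (x₀ x₁ : V) (i : Fin n) : V :=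
  if A.initVal i = x₁ then x₀ else x₁

open Classical in
/-- The one of the two values `x₀` and `x₁` that counts as low in updates of process `i`. -/
noncomputable def lowValue (A : Algorithm.{u, v, w} n V) (x₀ x₁ : V) (i : Fin n) : V :=
  if A.initVal i = x₁ then x₁ else x₀

/-- The initial update must count as low, even if the initial value is neither `x₀` nor `x₁`. It
need not equal the low value that is written later. -/
theorem initVal_ne_highValue {x₀ x₁ : V} (hx : x₀ ≠ x₁) (i : Fin n) :
    A.initVal i ≠ A.highValue x₀ x₁ i := by
  unfold highValue
  split_ifs with h
  · rw [h]
    exact hx.symm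
  · exact h

theorem lowValue_ne_highValue {x₀ x₁ : V} (hx : x₀ ≠ x₁) (i : Fin n) :
    A.lowValue x₀ x₁ i ≠ A.highValue x₀ x₁ i := by
  unfold lowValue highValue
  split_ifs
  exacts [hx.symm, hx]

/-- Binary executions suffice: for given thresholds `θ`, there is a similar binary execution in
which exactly the updates of `i` from `θ i` on are high, and scans return a high entry iff the
update they read is high. -/
theorem exists_threshold_exec (hS : A.ScheduleBased) (hB : A.ArgumentsDoNotBlock) {x₀ x₁ : V}
    (hx : x₀ ≠ x₁) {τ : Exec n V} (h : A.IsExec τ) {α : Fin n → Event n → Event n}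
    (hα : ∀ i S, IsCompleteScan τ S → IsUpdate τ i (α i S))
    (hval : ∀ τ', A.IsExec τ' → Similar τ τ' → ∀ S, IsCompleteScan τ S →
      ∃ z, Returns τ' S z ∧ ∀ i, HasArg A.initVal τ' (α i S) (z i)) (θ : Fin n → ℕ) :
    ∃ τ', A.IsExec τ' ∧ IsBinaryExec x₀ x₁ τ' ∧
      (∀ i, IsThreshold (A.highValue x₀ x₁) τ' i) ∧
      (∀ i E, IsScan τ i E ↔ IsScan τ' i E) ∧ (∀ i E, IsUpdate τ i E ↔ IsUpdate τ' i E) ∧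
      (∀ i l, HighAt (A.highValue x₀ x₁) τ' i l → θ i ≤ l + 1) ∧
      (∀ i U l, IsUpdate τ i U → U.start = l + 1 → θ i ≤ l + 1 →
        HighAt (A.highValue x₀ x₁) τ' i l) ∧
      ∀ k s t, IsScan τ k (.complete s t) → ∃ z, τ'[t]? = some (k, .endScan z) ∧
        ∀ i, 0 < θ i → (z i = A.highValue x₀ x₁ i ↔ θ i ≤ (α i (.complete s t)).start) := by
  classical
  obtain ⟨s, hs⟩ := id h
  obtain ⟨τ', h', hsim, hargs⟩ := exists_similar_of_args hS hB
    -- Thresholds are compared with `Event.start`, which is `l + 1` for an operation that begins at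
    -- position `l`.
    (fun i l => if θ i ≤ l + 1 then A.highValue x₀ x₁ i else A.lowValue x₀ x₁ i) hs
  have hhigh : ∀ i l, HighAt (A.highValue x₀ x₁) τ' i l → θ i ≤ l + 1 := fun i l hl => by
    have := hargs l i _ hl
    by_contra hnot
    rw [if_neg hnot] at this
    exact lowValue_ne_highValue hx i this.symm
  have hupd : ∀ i U l, IsUpdate τ i U → U.start = l + 1 →
      ∃ x, τ'[l]? = some (i, .startUpdate x) := fun i U l hU hl => by
    rw [hS.isUpdate_iff h h' hsim] at hU
    obtain ⟨a, ha, -⟩ := hU.1.isFirst hl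
    obtain ⟨-, hU⟩ := hU
    cases U with
    | initial j => simp [Event.start] at hl
    | complete s t => obtain rfl : s = l := by simpa [Event.start] using hl
                      exact hU
    | pending s => obtain rfl : s = l := by simpa [Event.start] using hl
                   exact hU
  refine ⟨τ', h', ?_, ?_, fun i E => hS.isScan_iff h h' hsim i E,
    fun i E => hS.isUpdate_iff h h' hsim i E, hhigh, ?_, ?_⟩
  · rintro ⟨i, a⟩ he
    obtain ⟨l, hl⟩ := List.mem_iff_getElem?.1 he
    cases a with
    | startUpdate x =>
      have := hargs l i x hl
      simp only [highValue, lowValue] at this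
      simp only [Action.IsBinary]
      split_ifs at this <;> simp [this]
    | _ => trivial
  · intro i l l' x hl hlt hl'
    rw [hargs l' i x hl', if_pos ((hhigh i l hl).trans (by omega))]
  · intro i U l hU hl hle
    obtain ⟨x, hx'⟩ := hupd i U l hU hl
    have := hargs l i x hx'
    rw [if_pos hle] at this
    rwa [HighAt, ← this]
  · intro k s t hst
    have hcs : IsCompleteScan τ (.complete s t) := ⟨⟨k, hst⟩, trivial⟩
    obtain ⟨z, ⟨p, hz⟩, hz'⟩ := hval τ' h' hsim _ hcs
    have hst' := (hS.isScan_iff h h' hsim _ _).1 hst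
    obtain ⟨a, ha, -⟩ := hst'.1.2.2.1
    obtain ⟨rfl, rfl⟩ := Prod.mk.inj (Option.some.inj (ha.symm.trans hz))
    refine ⟨z, hz, fun i hi => ?_⟩
    have hU := (hS.isUpdate_iff h h' hsim _ _).1 (hα i _ hcs)
    have harg := hz' i
    rcases Nat.eq_zero_or_pos (α i (.complete s t)).start with h0 | h0
    -- The initial update has start 0 and is low, which is why the equivalence requires a positive
    -- threshold.
    · rw [hU.eq_initial h0] at harg
      rw [show z i = A.initVal i from harg, h0]
      exact ⟨fun h => absurd h (initVal_ne_highValue hx i), fun h => absurd hi (by omega)⟩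
    · obtain ⟨l, hl⟩ := Nat.exists_eq_succ_of_ne_zero h0.ne'
      rw [hU.hasArg_iff_of_start hl] at harg
      have := hargs l i _ harg
      rw [this, hl]
      split_ifs with hle
      · exact ⟨fun _ => hle, fun _ => rfl⟩
      · exact ⟨fun h => absurd h (lowValue_ne_highValue hx i), fun h => absurd h hle⟩

/-- For each condition, thresholds at the starts of the offending updates separate what a scan reads
from what it should read. The entries returned then reveal the failure as a violation. -/
theorem consistent_of_no_violation (hS : A.ScheduleBased) (hB : A.ArgumentsDoNotBlock) {x₀ x₁ : V}
    (hx : x₀ ≠ x₁)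
    (hno : ∀ τ, A.IsExec τ → IsBinaryExec x₀ x₁ τ →
      (∀ i, IsThreshold (A.highValue x₀ x₁) τ i) → ∀ i j k, ¬ Violation (A.highValue x₀ x₁) τ i j k)
    {τ : Exec n V} (h : A.IsExec τ) {α : Fin n → Event n → Event n}
    (hα : ∀ i S, IsCompleteScan τ S → IsUpdate τ i (α i S))
    (hval : ∀ τ', A.IsExec τ' → Similar τ τ' → ∀ S, IsCompleteScan τ S →
      ∃ z, Returns τ' S z ∧ ∀ i, HasArg A.initVal τ' (α i S) (z i)) :
    Consistent τ α := by
  have hexec := exists_threshold_exec hS hB hx h hα hval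
  have hcomplete : ∀ S, IsCompleteScan τ S → ∃ k s t, S = .complete s t ∧ IsScan τ k S := by
    rintro S ⟨⟨k, hk⟩, hc⟩
    cases S with
    | initial j => exact hk.2.elim
    | complete s t => exact ⟨k, s, t, rfl, hk⟩
    | pending s => exact hc.elim
  refine ⟨?_, ?_, ?_, ?_, ?_⟩
  · intro S i hcs hprec
    obtain ⟨k, s, t, rfl, hk⟩ := hcomplete S hcs
    obtain ⟨l, hl, htl⟩ : ∃ l, (α i (.complete s t)).start = l + 1 ∧ t < l := by
      generalize α i (.complete s t) = U at hprec
      cases U with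
      | initial j => exact hprec.elim
      | complete s' t' => exact ⟨s', rfl, hprec⟩
      | pending s' => exact ⟨s', rfl, hprec⟩
    -- With the threshold at the update read by `S`, the scan returns a high entry although no high
    -- update has started when it ends.
    obtain ⟨τ', h', hbin, hthr, -, -, hhigh, -, hret⟩ := hexec fun _ => l + 1
    obtain ⟨z, hz, hz'⟩ := hret k s t hk
    refine hno τ' h' hbin hthr i i k (Or.inl ⟨t, z, ⟨k, hz⟩, (hz' i l.succ_pos).2 hl.ge, ?_⟩)
    intro l' hl' hl''
    have := hhigh i l' hl''
    omega
  · intro S i U hcs hU hprec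
    obtain ⟨k, s, t, rfl, hk⟩ := hcomplete S hcs
    by_contra! hlt
    -- With the threshold at `U`, a high update is over before `S` starts, yet `S` reads an older,
    -- low one.
    obtain ⟨τ', h', hbin, hthr, hscan, hupd, -, hhigh, hret⟩ := hexec fun _ => U.start
    obtain ⟨z, hz, hz'⟩ := hret k s t hk
    cases U with
    | initial j => simp [Event.start] at hlt
    | pending l => exact hprec
    | complete l₁ t₁ =>
      refine hno τ' h' hbin hthr i i k (Or.inr (Or.inl ⟨s, t, z, hk.1.1, ⟨((hscan _ _).1 hk).2,
        Or.inl ⟨l₁, t₁, hU.1.1, hprec, hhigh i _ l₁ hU rfl le_rfl, ((hupd _ _).1 hU).1.2.2.1⟩⟩, hz,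
        fun hzi => ?_⟩))
      exact absurd ((hz' i (Nat.succ_pos _)).1 hzi) (not_le.2 hlt)
  · intro S S' hcs hcs'
    obtain ⟨k, s, t, rfl, hk⟩ := hcomplete S hcs
    obtain ⟨k', s', t', rfl, hk'⟩ := hcomplete S' hcs'
    by_contra! hlt
    obtain ⟨⟨i, hi⟩, j, hj⟩ := hlt
    -- The larger of the two starts separates the scans in both entries: only `S` is high at `i`,
    -- and only `S'` is high at `j`.
    obtain ⟨τ', h', hbin, hthr, -, -, -, -, hret⟩ := hexec fun m =>
      max (α m (.complete s t)).start (α m (.complete s' t')).start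
    obtain ⟨z, hz, hz₁⟩ := hret k s t hk
    obtain ⟨z', hz', hz'₁⟩ := hret k' s' t' hk'
    have hi' := lt_max_of_lt_left (c := (α i (.complete s' t')).start) (Nat.zero_lt_of_lt hi)
    have hj' := lt_max_of_lt_right (b := (α j (.complete s t)).start) (Nat.zero_lt_of_lt hj)
    refine hno τ' h' hbin hthr i j k (Or.inr (Or.inr ⟨⟨t', z', ⟨k', hz'⟩, ?_, ?_⟩,
      Or.inl ⟨t, z, ⟨k, hz⟩, ?_, ?_⟩⟩))
    · rw [Ne, hz'₁ i hi', max_le_iff]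
      omega
    · rw [hz'₁ j hj', max_le_iff]
      omega
    · rw [hz₁ i hi', max_le_iff]
      omega
    · rw [Ne, hz₁ j hj', max_le_iff]
      omega
  · intro S S' hcs hcs' hprec i
    obtain ⟨k, s, t, rfl, hk⟩ := hcomplete S hcs
    obtain ⟨k', s', t', rfl, hk'⟩ := hcomplete S' hcs'
    by_contra! hlt
    -- With the threshold at the update read by `S`, the high entry of `S` arms the scan `S'`, which
    -- then returns a low one.
    obtain ⟨τ', h', hbin, hthr, hscan, -, -, -, hret⟩ := hexec fun _ => (α i (.complete s t)).start
    obtain ⟨z, hz, hz₁⟩ := hret k s t hk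
    obtain ⟨z', hz', hz'₁⟩ := hret k' s' t' hk'
    have hpos := Nat.zero_lt_of_lt hlt
    exact hno τ' h' hbin hthr i i k' (Or.inr (Or.inl ⟨s', t', z', hk'.1.1,
      ⟨((hscan _ _).1 hk').2, Or.inr ⟨t, hprec, z, ⟨k, hz⟩, (hz₁ i hpos).2 le_rfl⟩⟩, hz',
      fun hzi => absurd ((hz'₁ i hpos).1 hzi) (not_le.2 hlt)⟩))
  · intro S i j U U' hcs hU hU' hprec hle
    obtain ⟨k, s, t, rfl, hk⟩ := hcomplete S hcs
    by_contra! hlt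
    have hstart := hprec.start_lt hU.1 hU'.1
    have hij : j ≠ i := by
      rintro rfl
      omega
    -- Now `U` and `U'` are the first high updates of `i` and `j`, and `U` ends before `U'` starts,
    -- but `S` is low at `i` and high at `j`.
    obtain ⟨τ', h', hbin, hthr, hscan, hupd, hlow, hhigh, hret⟩ := hexec fun m =>
      if m = i then U.start else U'.start
    obtain ⟨z, hz, hz₁⟩ := hret k s t hk
    have hi := hz₁ i
    have hj := hz₁ j
    have hlowj := hlow j
    have hhighi := hhigh i U
    have hhighj := hhigh j U'
    simp only [if_true, if_neg hij] at hi hj hlowj hhighi hhighj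
    obtain ⟨l', hl'⟩ := Nat.exists_eq_succ_of_ne_zero (Nat.ne_zero_of_lt hstart)
    cases U with
    | initial j => simp [Event.start] at hlt
    | pending l => cases U' <;> exact hprec
    | complete l₁ t₁ =>
      refine hno τ' h' hbin hthr i j k (Or.inr (Or.inr ⟨⟨t, z, ⟨k, hz⟩, fun hzi => ?_, ?_⟩,
        Or.inr ⟨l', hhighj l' hU' hl' hl'.le, fun l'' hlt hl'' => ?_, l₁, t₁, hU.1.1, ?_,
          hhighi l₁ hU rfl le_rfl, ((hupd _ _).1 hU).1.2.2.1⟩⟩))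
      · exact absurd ((hi (Nat.succ_pos _)).1 hzi) (not_le.2 hlt)
      · exact (hj (Nat.zero_lt_of_lt hstart)).2 hle
      · have := hlowj l'' hl''
        omega
      · cases U' <;> simp_all [Event.start, Precedes]

/-- Correctness of a schedule-based algorithm can be tested with binary executions and the
monitors. -/
theorem correct_iff_forall_accepts (hS : A.ScheduleBased) (hB : A.ArgumentsDoNotBlock) {x₀ x₁ : V}
    (hx : x₀ ≠ x₁) : A.Correct ↔ ∀ τ, A.IsExec τ → IsBinaryExec x₀ x₁ τ → ∀ i j k,
      ¬ (execMonitor (A.highValue x₀ x₁) i j k τ).accepts = true := by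
  simp only [execMonitor_accepts]
  constructor
  · rintro hc τ h - i j k ⟨⟨hi, hj⟩, hv⟩
    exact hv.not_linearizable h.wellFormed (initVal_ne_highValue hx) hi hj (hc τ h)
  · intro hno τ h
    obtain ⟨α, hα, hτ⟩ := hS τ h
    have hα' : ∀ i S, IsCompleteScan τ S → IsUpdate τ i (α i S) := fun i S ⟨⟨k, hk⟩, hc⟩ =>
      hα i k S hk hc
    have hval : ∀ τ', A.IsExec τ' → Similar τ τ' → ∀ S, IsCompleteScan τ S →
        ∃ z, Returns τ' S z ∧ ∀ i, HasArg A.initVal τ' (α i S) (z i) :=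
      fun τ' h' hsim S ⟨⟨k, hk⟩, hc⟩ => (hτ τ' h' hsim).2 k S hk hc
    exact (consistent_of_no_violation hS hB hx
      (fun τ h hb ht i j k hv => hno τ h hb i j k ⟨⟨ht i, ht j⟩, hv⟩) h hα' hval).linearizable
      h.wellFormed hα' (hval τ h (Similar.refl τ))

end Algorithm

/-! ### Reachability by iterated closure. -/

section Closure

variable {α : Type*}

/-- Iterating a one-step closure of lists computes the set of reachable elements, if the number of
iterations is at least the size of a finite set that contains all of them. -/
theorem mem_iterate_iff_reflTransGen {R : α → α → Prop} {f : List α → List α}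
    (hf : ∀ L y, y ∈ f L ↔ y ∈ L ∨ ∃ x ∈ L, R x y) {a : α} {U : Finset α} (haU : a ∈ U)
    (hU : ∀ x y, R x y → y ∈ U) {N : ℕ} (hN : U.card ≤ N) (x : α) :
    x ∈ f^[N] [a] ↔ Relation.ReflTransGen R a x := by
  classical
  have hsub : ∀ k, (f^[k] [a]).toFinset ⊆ U := fun k => by
    induction k with
    | zero => simpa using haU
    | succ k ih =>
      intro y hy
      rw [Function.iterate_succ_apply', List.mem_toFinset, hf] at hy
      rcases hy with hy | ⟨x, -, hxy⟩
      · exact ih (List.mem_toFinset.2 hy)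
      · exact hU x y hxy
  -- As long as the list is not closed, every round adds a new element; after `U.card` rounds there
  -- is no room left for one.
  have hclosed : ∀ k, (∀ x ∈ f^[k] [a], ∀ y, R x y → y ∈ f^[k] [a]) ∨
      k + 1 ≤ (f^[k] [a]).toFinset.card := fun k => by
    induction k with
    | zero => exact Or.inr (by simp)
    | succ k ih =>
      by_cases hc : ∀ x ∈ f^[k] [a], ∀ y, R x y → y ∈ f^[k] [a]
      · left
        intro x hx y hxy
        rw [Function.iterate_succ_apply', hf] at hx ⊢
        refine Or.inl (hc x ?_ y hxy)
        rcases hx with hx | ⟨x', hx', hxx'⟩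
        · exact hx
        · exact hc x' hx' x hxx'
      · right
        have hk := ih.resolve_left hc
        push Not at hc
        obtain ⟨x, hx, y, hxy, hy⟩ := hc
        refine Nat.succ_le_of_lt (hk.trans_lt (Finset.card_lt_card
          ((Finset.ssubset_iff_of_subset ?_).2 ⟨y, ?_, by simpa using hy⟩)))
        · intro z hz
          rw [List.mem_toFinset] at hz
          rw [Function.iterate_succ_apply', List.mem_toFinset, hf]
          exact Or.inl hz
        · rw [Function.iterate_succ_apply', List.mem_toFinset, hf]
          exact Or.inr ⟨x, hx, hxy⟩
  constructor
  · have : ∀ k x, x ∈ f^[k] [a] → Relation.ReflTransGen R a x := fun k => by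
      induction k with
      | zero =>
        intro x hx
        rw [Function.iterate_zero, id, List.mem_singleton] at hx
        rw [hx]
      | succ k ih =>
        intro x hx
        rw [Function.iterate_succ_apply', hf] at hx
        rcases hx with hx | ⟨x', hx', hxx'⟩
        · exact ih x hx
        · exact (ih x' hx').tail hxx'
    exact this N x
  · have hN' := (hclosed N).resolve_right fun h =>
      absurd (h.trans (Finset.card_le_card (hsub N))) (by omega)
    intro h
    induction h with
    | refl =>
      have : ∀ k, a ∈ f^[k] [a] := fun k => by
        induction k with
        | zero => simp
        | succ k ih =>
          rw [Function.iterate_succ_apply', hf]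
          exact Or.inl ih
      exact this N
    | tail _ hxy ih => exact hN' _ ih _ hxy

end Closure

/-! ### The decision procedure. -/

section Decision

instance : Finite Letter :=
  Finite.of_injective (fun c : Letter => (c.highI, c.lowI, c.endI, c.highJ, c.lowJ, c.scanK, c.byK,
    c.ret, c.retHighI, c.retHighJ)) fun c d h => by
      simp only [Prod.mk.injEq] at h
      ext <;> simp [h]

instance : Finite Monitor :=
  Finite.of_injective (fun m : Monitor => (m.highI, m.doneI, m.highJ, m.dead, m.ordered, m.lowHigh,
    m.highLow, m.high, m.armed, m.early, m.stale)) fun c d h => by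
      simp only [Prod.mk.injEq] at h
      ext <;> simp [h]

/-- An arbitrary coding of the finite types `Letter` and `Monitor` will do, since every function on
a finite type is primitive recursive. -/
noncomputable instance : Primcodable Letter :=
  Primcodable.ofEquiv _ (Finite.equivFin Letter)

noncomputable instance : Primcodable Monitor :=
  Primcodable.ofEquiv _ (Finite.equivFin Monitor)

/-- One step of the exploration of the product of a labelled transition system with the monitor. -/
def exploreStep (E : List (ℕ × Letter × ℕ)) (L : List (ℕ × Monitor)) : List (ℕ × Monitor) :=
  L ++ E.flatMap fun e => L.filterMap fun x =>
    if x.1 = e.1 then some (e.2.2, x.2.step e.2.1) else none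

/-- The reachable states of the product of a labelled transition system with the monitor. -/
noncomputable def explore (E : List (ℕ × Letter × ℕ)) (q : ℕ) : List (ℕ × Monitor) :=
  (exploreStep E)^[(E.length + 1) * Nat.card Monitor] [(q, .init)]

/-- The transitions of the product of a labelled transition system with the monitor. -/
def ProductStep (E : List (ℕ × Letter × ℕ)) (x y : ℕ × Monitor) : Prop :=
  ∃ c, (x.1, c, y.1) ∈ E ∧ y.2 = x.2.step c

theorem mem_exploreStep {E : List (ℕ × Letter × ℕ)} {L : List (ℕ × Monitor)} {y : ℕ × Monitor} :
    y ∈ exploreStep E L ↔ y ∈ L ∨ ∃ x ∈ L, ProductStep E x y := by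
  obtain ⟨q, m⟩ := y
  simp only [exploreStep, List.mem_append, List.mem_flatMap, List.mem_filterMap, ProductStep,
    Option.ite_none_right_eq_some, Option.some.injEq, Prod.mk.injEq]
  refine or_congr_right ⟨?_, ?_⟩
  · rintro ⟨⟨p, c, q'⟩, he, x, hx, rfl, rfl, rfl⟩
    exact ⟨x, hx, c, he, rfl⟩
  · rintro ⟨x, hx, c, he, rfl⟩
    exact ⟨_, he, x, hx, rfl, rfl, rfl⟩

theorem mem_explore {E : List (ℕ × Letter × ℕ)} {q : ℕ} {x : ℕ × Monitor} :
    x ∈ explore E q ↔ Relation.ReflTransGen (ProductStep E) (q, .init) x := by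
  classical
  have := Fintype.ofFinite Monitor
  refine mem_iterate_iff_reflTransGen (fun _ _ => mem_exploreStep)
    -- A reachable state is the start or the target of a transition, which gives the bound on the
    -- number of rounds in `explore`.
    (U := (q :: E.map fun e => e.2.2).toFinset ×ˢ Finset.univ) (by simp) ?_ ?_ x
  · rintro x y ⟨c, hc, -⟩
    simp only [Finset.mem_product, List.mem_toFinset, Finset.mem_univ, and_true, List.mem_cons,
      List.mem_map]
    exact Or.inr ⟨_, hc, rfl⟩
  · rw [Finset.card_product, Finset.card_univ, ← Nat.card_eq_fintype_card]
    exact Nat.mul_le_mul_right _ ((List.toFinset_card_le _).trans (by simp))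

/-- The high value of process `i` in a table. -/
def Table.highValue (T : Table) (i : ℕ) : ℕ :=
  if T.initVals.getD i 0 = 1 then 0 else 1

/-- The transitions of a table, labelled by what the monitor sees of them. -/
def Table.letterTrans (T : Table) (i j k : ℕ) : List (ℕ × Letter × ℕ) :=
  T.trans.map fun e => (e.1, observe i j k (T.highValue i) (T.highValue j) (fun z => z.getD i 0)
    (fun z => z.getD j 0) (e.2.1, e.2.2.1), e.2.2.2)

/-- The reachable product states in which one of the monitors accepts. -/
noncomputable def Table.badStates (T : Table) : List (ℕ × Monitor) :=
  (List.range T.procs).flatMap fun i => (List.range T.procs).flatMap fun j =>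
    (List.range T.procs).flatMap fun k =>
      (explore (T.letterTrans i j k) T.start).filter fun x => x.2.accepts

/-- The decision procedure: no monitor accepts. -/
noncomputable def Table.check (T : Table) : Bool :=
  decide (T.badStates.length = 0)

theorem Table.check_eq_true {T : Table} : T.check = true ↔
    ∀ i < T.procs, ∀ j < T.procs, ∀ k < T.procs, ∀ x : ℕ × Monitor,
      Relation.ReflTransGen (ProductStep (T.letterTrans i j k)) (T.start, .init) x →
        ¬ x.2.accepts = true := by
  rw [check, decide_eq_true_iff, List.length_eq_zero_iff]
  simp only [badStates, List.flatMap_eq_nil_iff,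
    List.mem_range, List.filter_eq_nil_iff, mem_explore]

end Decision

/-! ### Primitive recursiveness of the procedure. -/

section Computability

theorem primrec_equivSum : Primrec (Action.equivSum ℕ (List ℕ)) := Primrec.of_equiv

theorem primrec_arg? : Primrec (Action.arg? : Action ℕ (List ℕ) → Option ℕ) :=
  (Primrec.sumCasesOn primrec_equivSum (g := fun _ o => o) (h := fun _ _ => none)
    Primrec.snd.to₂ (Primrec.const none).to₂).of_eq fun a => by cases a <;> rfl

theorem primrec_result? : Primrec (Action.result? : Action ℕ (List ℕ) → Option (List ℕ)) :=
  (Primrec.sumCasesOn primrec_equivSum (g := fun _ _ => none) (h := fun _ o => o.bind id)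
    (Primrec.const none).to₂ (Primrec.option_bind Primrec.snd Primrec.snd.to₂).to₂).of_eq
      fun a => by cases a <;> rfl

theorem primrec_startsScan : Primrec (Action.startsScan : Action ℕ (List ℕ) → Bool) :=
  (Primrec.sumCasesOn primrec_equivSum (g := fun _ o => !o.isSome) (h := fun _ _ => false)
    (Primrec.not.comp (Primrec.option_isSome.comp Primrec.snd)).to₂
      (Primrec.const false).to₂).of_eq fun a => by cases a <;> rfl

theorem primrec_ends : Primrec (Action.ends : Action ℕ (List ℕ) → Bool) :=
  (Primrec.sumCasesOn primrec_equivSum (g := fun _ _ => false) (h := fun _ o => o.isSome)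
    (Primrec.const false).to₂ (Primrec.option_isSome.comp Primrec.snd).to₂).of_eq
      fun a => by cases a <;> rfl

/-- A letter, given by its components. -/
def letterOfBools (x : Bool × Bool × Bool × Bool × Bool × Bool × Bool × Bool × Bool × Bool) :
    Letter :=
  ⟨x.1, x.2.1, x.2.2.1, x.2.2.2.1, x.2.2.2.2.1, x.2.2.2.2.2.1, x.2.2.2.2.2.2.1,
    x.2.2.2.2.2.2.2.1, x.2.2.2.2.2.2.2.2.1, x.2.2.2.2.2.2.2.2.2⟩

theorem primrec_decide_eq {α β : Type*} [Primcodable α] [Primcodable β] [DecidableEq β]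
    {f g : α → β} (hf : Primrec f) (hg : Primrec g) : Primrec fun a => decide (f a = g a) :=
  (Primrec.eq.comp hf hg).decide

theorem primrec_observe {α : Type*} [Primcodable α] {i j k bi bj p : α → ℕ}
    {a : α → Action ℕ (List ℕ)} (hi : Primrec i) (hj : Primrec j) (hk : Primrec k)
    (hbi : Primrec bi) (hbj : Primrec bj) (hp : Primrec p) (ha : Primrec a) :
    Primrec fun x => observe (i x) (j x) (k x) (bi x) (bj x) (fun z => z.getD (i x) 0)
      (fun z => z.getD (j x) 0) (p x, a x) := by
  have harg := primrec_arg?.comp ha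
  have hres := primrec_result?.comp ha
  have hget : ∀ {m : α → ℕ}, Primrec m →
      Primrec fun x => (a x).result?.map fun z => z.getD (m x) 0 := fun hm =>
    Primrec.option_map hres ((Primrec.list_getD 0).comp₂ Primrec₂.right
      (hm.comp₂ Primrec₂.left))
  have hnone : Primrec fun x => decide ((a x).arg? = none) :=
    primrec_decide_eq harg (Primrec.const none)
  have hpi := primrec_decide_eq hp hi
  have hpj := primrec_decide_eq hp hj
  have hpk := primrec_decide_eq hp hk
  have hai := primrec_decide_eq harg (Primrec.option_some.comp hbi)
  have haj := primrec_decide_eq harg (Primrec.option_some.comp hbj)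
  -- The ten bits are computed separately and assembled by a function with finite domain.
  exact (Primrec.dom_finite letterOfBools).comp <|
    (Primrec.and.comp hpi hai).pair <|
    (Primrec.and.comp (Primrec.and.comp hpi (Primrec.not.comp hnone))
      (Primrec.not.comp hai)).pair <|
    (Primrec.and.comp hpi (primrec_ends.comp ha)).pair <|
    (Primrec.and.comp hpj haj).pair <|
    (Primrec.and.comp (Primrec.and.comp hpj (Primrec.not.comp hnone))
      (Primrec.not.comp haj)).pair <|
    (Primrec.and.comp hpk (primrec_startsScan.comp ha)).pair <|
    hpk.pair <|
    (Primrec.not.comp (primrec_decide_eq (hget hi) (Primrec.const none))).pair <|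
    (primrec_decide_eq (hget hi) (Primrec.option_some.comp hbi)).pair <|
    (primrec_decide_eq (hget hj) (Primrec.option_some.comp hbj))

theorem primrec_equivProd : Primrec Table.equivProd := Primrec.of_equiv

theorem primrec_procs : Primrec Table.procs := Primrec.fst.comp primrec_equivProd

theorem primrec_initVals : Primrec Table.initVals :=
  Primrec.fst.comp (Primrec.snd.comp primrec_equivProd)

theorem primrec_start : Primrec Table.start :=
  Primrec.fst.comp (Primrec.snd.comp (Primrec.snd.comp primrec_equivProd))

theorem primrec_trans : Primrec Table.trans :=
  Primrec.snd.comp (Primrec.snd.comp (Primrec.snd.comp primrec_equivProd))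

theorem primrec_tableHighValue : Primrec₂ Table.highValue := by
  have hget : Primrec fun x : Table × ℕ => x.1.initVals.getD x.2 0 :=
    (Primrec.list_getD 0).comp (primrec_initVals.comp Primrec.fst) Primrec.snd
  exact Primrec.ite (Primrec.eq.comp hget (Primrec.const 1)) (Primrec.const 0) (Primrec.const 1)

theorem primrec_letterTrans :
    Primrec fun x : Table × ℕ × ℕ × ℕ => x.1.letterTrans x.2.1 x.2.2.1 x.2.2.2 := by
  have hx : Primrec fun y : (Table × ℕ × ℕ × ℕ) × (ℕ × ℕ × Action ℕ (List ℕ) × ℕ) => y.1 :=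
    Primrec.fst
  have hi := Primrec.fst.comp (Primrec.snd.comp hx)
  have hj := Primrec.fst.comp (Primrec.snd.comp (Primrec.snd.comp hx))
  have hk := Primrec.snd.comp (Primrec.snd.comp (Primrec.snd.comp hx))
  have he : Primrec fun y : (Table × ℕ × ℕ × ℕ) × (ℕ × ℕ × Action ℕ (List ℕ) × ℕ) => y.2 :=
    Primrec.snd
  have hT := Primrec.fst.comp hx
  exact Primrec.list_map (primrec_trans.comp Primrec.fst)
    ((Primrec.fst.comp he).pair ((primrec_observe hi hj hk (primrec_tableHighValue.comp hT hi)
      (primrec_tableHighValue.comp hT hj) (Primrec.fst.comp (Primrec.snd.comp he))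
      (Primrec.fst.comp (Primrec.snd.comp (Primrec.snd.comp he)))).pair
      (Primrec.snd.comp (Primrec.snd.comp (Primrec.snd.comp he))))).to₂

theorem primrec_exploreStep : Primrec₂ exploreStep := by
  have hstep : Primrec₂ Monitor.step :=
    Primrec.dom_finite fun x : Monitor × Letter => x.1.step x.2
  have hx : Primrec fun y : ((List (ℕ × Letter × ℕ) × List (ℕ × Monitor)) × (ℕ × Letter × ℕ)) ×
      (ℕ × Monitor) => y.2 := Primrec.snd
  have he : Primrec fun y : ((List (ℕ × Letter × ℕ) × List (ℕ × Monitor)) × (ℕ × Letter × ℕ)) ×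
      (ℕ × Monitor) => y.1.2 := Primrec.snd.comp Primrec.fst
  have hL : Primrec fun y : (List (ℕ × Letter × ℕ) × List (ℕ × Monitor)) × (ℕ × Letter × ℕ) =>
      y.1.2 := Primrec.snd.comp Primrec.fst
  exact (Primrec.list_append.comp Primrec.snd (Primrec.list_flatMap Primrec.fst
    (Primrec.listFilterMap hL
      (Primrec.ite (Primrec.eq.comp (Primrec.fst.comp hx) (Primrec.fst.comp he))
        (Primrec.option_some.comp ((Primrec.snd.comp (Primrec.snd.comp he)).pair
          (hstep.comp (Primrec.snd.comp hx) (Primrec.fst.comp (Primrec.snd.comp he)))))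
        (Primrec.const none)).to₂).to₂)).to₂

theorem primrec_explore : Primrec₂ explore := by
  have hE : Primrec fun x : List (ℕ × Letter × ℕ) × ℕ => x.1 := Primrec.fst
  have hinit : Primrec fun x : List (ℕ × Letter × ℕ) × ℕ => [(x.2, Monitor.init)] :=
    Primrec.list_cons.comp (Primrec.snd.pair (Primrec.const Monitor.init)) (Primrec.const [])
  exact (Primrec.nat_iterate
    (Primrec.nat_mul.comp (Primrec.succ.comp (Primrec.list_length.comp hE))
      (Primrec.const (Nat.card Monitor))) hinit
    (primrec_exploreStep.comp (hE.comp Primrec.fst) Primrec.snd).to₂).to₂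

theorem primrec_badStates : Primrec Table.badStates := by
  have hrange : Primrec fun T : Table => List.range T.procs :=
    Primrec.list_range.comp primrec_procs
  have haccepts : PrimrecPred fun x : ℕ × Monitor => x.2.accepts = true :=
    Primrec.eq.comp ((Primrec.dom_finite Monitor.accepts).comp Primrec.snd) (Primrec.const true)
  have hfilter : Primrec fun L : List (ℕ × Monitor) => L.filter fun x => x.2.accepts :=
    (Primrec.listFilter haccepts).of_eq fun L => by simp
  have hT : Primrec fun y : ((Table × ℕ) × ℕ) × ℕ => y.1.1.1 :=
    Primrec.fst.comp (Primrec.fst.comp Primrec.fst)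
  have hparam : Primrec fun y : ((Table × ℕ) × ℕ) × ℕ => (y.1.1.1, y.1.1.2, y.1.2, y.2) :=
    hT.pair ((Primrec.snd.comp (Primrec.fst.comp Primrec.fst)).pair
      ((Primrec.snd.comp Primrec.fst).pair Primrec.snd))
  exact Primrec.list_flatMap hrange (Primrec.list_flatMap (hrange.comp Primrec.fst)
    (Primrec.list_flatMap (hrange.comp (Primrec.fst.comp Primrec.fst))
      (hfilter.comp (primrec_explore.comp (primrec_letterTrans.comp hparam)
        (primrec_start.comp hT))).to₂).to₂).to₂

theorem computable_check : Computable Table.check :=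
  (primrec_decide_eq (Primrec.list_length.comp primrec_badStates) (Primrec.const 0)).to_comp

end Computability

/-! ### Tables represent the binary part of an algorithm. -/

namespace Algorithm

variable {n : ℕ} {V : Type u} {A : Algorithm.{u, v, w} n V} {x₀ x₁ : V}

theorem isBinaryExec_snoc {τ : Exec n V} {i : Fin n} {a : Action V (Fin n → V)} :
    IsBinaryExec x₀ x₁ (τ ++ [(i, a)]) ↔ IsBinaryExec x₀ x₁ τ ∧ a.IsBinary x₀ x₁ := by
  simp [IsBinaryExec, or_imp, forall_and]

theorem mem_binaryStates_of_step {s s' : A.State} {i : Fin n} {a : Action V (Fin n → V)}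
    (hs : s ∈ A.binaryStates x₀ x₁) (h : A.Step s i a s') (ha : a.IsBinary x₀ x₁) :
    s' ∈ A.binaryStates x₀ x₁ :=
  let ⟨_, hτ, hr⟩ := hs
  ⟨_, isBinaryExec_snoc.2 ⟨hτ, ha⟩, hr.snoc h⟩

/-- In a schedule-based algorithm, the entries of returned vectors are arguments of updates. -/
theorem ScheduleBased.returned_mem (hS : A.ScheduleBased) {s s' : A.State} {i : Fin n}
    {z : Fin n → V} (hs : s ∈ A.binaryStates x₀ x₁) (h : A.Step s i (.endScan z) s') (k : Fin n) :
    z k ∈ {x₀, x₁} ∪ Set.range A.initVal := by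
  obtain ⟨τ, hτ, hr⟩ := hs
  have hbin : IsBinaryExec x₀ x₁ (τ ++ [(i, .endScan z)]) := isBinaryExec_snoc.2 ⟨hτ, trivial⟩
  have hexec : A.IsExec (τ ++ [(i, .endScan z)]) := ⟨s', hr.snoc h⟩
  have hlast : (τ ++ [(i, .endScan z)])[τ.length]? = some (i, .endScan z) := by simp
  generalize τ ++ [(i, .endScan z)] = τ₁ at hbin hexec hlast
  obtain ⟨s₀, hscan, -⟩ := hexec.wellFormed.exists_scan hlast
  -- Schedule-basedness is applied to the execution as similar to itself: the returned entries are
  -- then arguments of updates of the same binary execution.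
  obtain ⟨α, hα, hret⟩ := hS _ hexec
  obtain ⟨z', ⟨j, hz'⟩, harg⟩ := (hret _ hexec (Similar.refl _)).2 i _ hscan trivial
  rw [hlast] at hz'
  obtain ⟨-, hz''⟩ := Prod.mk.inj (Option.some.inj hz')
  obtain rfl := Action.endScan.inj hz''
  have hU := hα k i _ hscan trivial
  have harg := harg k
  rcases Nat.eq_zero_or_pos (α k (.complete s₀ τ.length)).start with h0 | h0
  · rw [hU.eq_initial h0] at harg
    exact Or.inr ⟨k, harg.symm⟩
  · obtain ⟨l, hl⟩ := Nat.exists_eq_succ_of_ne_zero h0.ne'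
    exact Or.inl (hbin _ (List.mem_of_getElem? ((hU.hasArg_iff_of_start hl).1 harg)))

/-- Finitely many states alone would not make the table finite, since one transition relation could
return infinitely many vectors. -/
theorem ScheduleBased.finite_binaryValues (hS : A.ScheduleBased) :
    (A.binaryValues x₀ x₁).Finite := by
  refine ((Set.toFinite {x₀, x₁}).union (Set.finite_range A.initVal)).subset ?_
  rintro x (hx | ⟨s, hs, i, z, s', hstep, k, rfl⟩)
  · exact hx
  · exact hS.returned_mem hs hstep k

/-- The actions that occur in binary executions. -/
def binaryActions (A : Algorithm.{u, v, w} n V) (x₀ x₁ : V) : Set (Action V (Fin n → V)) :=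
  {.startScan, .internal, .endUpdate, .startUpdate x₀, .startUpdate x₁} ∪
    Action.endScan '' Set.univ.pi fun _ => A.binaryValues x₀ x₁

theorem mem_binaryActions {s s' : A.State} {i : Fin n} {a : Action V (Fin n → V)}
    (hs : s ∈ A.binaryStates x₀ x₁) (h : A.Step s i a s') (ha : a.IsBinary x₀ x₁) :
    a ∈ A.binaryActions x₀ x₁ := by
  cases a with
  | endScan z => exact Or.inr ⟨z, fun k _ => Or.inr ⟨s, hs, i, z, s', h, k, rfl⟩, rfl⟩
  | startUpdate x => rcases ha with rfl | rfl <;> simp [binaryActions]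
  | _ => simp [binaryActions]

theorem exists_describes (hS : A.ScheduleBased) (hF : A.IsFinite x₀ x₁) (hx : x₀ ≠ x₁) :
    ∃ T : Table, T.Describes A x₀ x₁ := by
  classical
  have hV := hS.finite_binaryValues (x₀ := x₀) (x₁ := x₁)
  obtain ⟨σ, hσ⟩ := Set.countable_iff_exists_injOn.1 hF.countable
  obtain ⟨g, hg⟩ := Set.countable_iff_exists_injOn.1 hV.countable
  -- The shift by 2 keeps the other names away from 0 and 1, which are reserved for `x₀` and `x₁`.
  set enc : V → ℕ := fun x => if x = x₀ then 0 else if x = x₁ then 1 else g x + 2 with henc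
  have hinj : Set.InjOn enc (A.binaryValues x₀ x₁) := by
    intro x hx y hy hxy
    simp only [henc] at hxy
    split_ifs at hxy with h1 h2 h3 h4 <;> first | omega | simp_all
    exact hg hx hy hxy
  have hactions : (A.binaryActions x₀ x₁).Finite :=
    (Set.toFinite _).union ((Set.Finite.pi fun _ => hV).image _)
  have hfin : {e | ∃ s ∈ A.binaryStates x₀ x₁, ∃ i a s', A.Step s i a s' ∧ a.IsBinary x₀ x₁ ∧
        e = (σ s, (i : ℕ), a.map enc (fun z => List.ofFn (fun k => enc (z k))), σ s')}.Finite := by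
    refine ((hF.prod (Set.finite_univ.prod (hactions.prod hF))).image
      fun y : A.State × Fin n × Action V (Fin n → V) × A.State => (σ y.1, (y.2.1 : ℕ),
        y.2.2.1.map enc (fun z => List.ofFn (fun k => enc (z k))), σ y.2.2.2)).subset ?_
    rintro e ⟨s, hs, i, a, s', hstep, ha, rfl⟩
    exact ⟨(s, i, a, s'), ⟨hs, trivial, mem_binaryActions hs hstep ha,
      mem_binaryStates_of_step hs hstep ha⟩, rfl⟩
  refine ⟨⟨n, List.ofFn fun i => enc (A.initVal i), σ A.initState, hfin.toFinset.toList⟩, σ, enc,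
    hσ, hinj, by simp [henc], by simp [henc, hx.symm], rfl, rfl, rfl, fun e => ?_⟩
  rw [Finset.mem_toList, Set.Finite.mem_toFinset, Set.mem_ofPred_eq]

/-- The monitor uses values only in equality tests with high values, so a naming that is injective
on the values that occur preserves what it sees. -/
theorem observe_map {b : Fin n → V} {enc : V → ℕ} {p : Fin n} {a : Action V (Fin n → V)}
    (hupd : ∀ x, a = .startUpdate x → ∀ m, enc x = enc (b m) ↔ x = b m)
    (hret : ∀ z, a = .endScan z → ∀ m, enc (z m) = enc (b m) ↔ z m = b m) (i j k : Fin n) :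
    observe (i : ℕ) (j : ℕ) (k : ℕ) (enc (b i)) (enc (b j)) (fun z => z.getD i 0)
        (fun z => z.getD j 0) ((p : ℕ), a.map enc (fun z => List.ofFn (fun k => enc (z k)))) =
      execLetter b i j k (p, a) := by
  set a' : Action ℕ (List ℕ) := a.map enc fun z => List.ofFn fun k => enc (z k) with ha'
  have harg : ∀ m, a'.arg? = some (enc (b m)) ↔ a.arg? = some (b m) := fun m => by
    cases a <;> simp_all [Action.map, Action.arg?]
  have hnone : a'.arg? = none ↔ a.arg? = none := by
    cases a <;> simp [ha', Action.map, Action.arg?]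
  have hstart : a'.startsScan = a.startsScan := by cases a <;> rfl
  have hends : a'.ends = a.ends := by cases a <;> rfl
  have hres : ∀ m : Fin n, a'.result?.map (fun z => z.getD m 0) = some (enc (b m)) ↔
      a.result?.map (fun z => z m) = some (b m) := fun m => by
    cases a <;> simp_all [Action.map, Action.result?]
  have hres' : ∀ m : Fin n, a'.result?.map (fun z => z.getD m 0) = none ↔
      a.result?.map (fun z => z m) = none := fun m => by
    cases a <;> simp [ha', Action.map, Action.result?]
  ext <;> rw [Bool.eq_iff_iff] <;>
    simp only [observe, execLetter, Bool.and_eq_true, decide_eq_true_eq, Bool.not_eq_true',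
      decide_eq_false_iff_not, harg, hnone, hstart, hends, hres, hres', Fin.ext_iff]

theorem execMonitor_snoc (b : Fin n → V) (i j k : Fin n) (τ : Exec n V)
    (e : Fin n × Action V (Fin n → V)) :
    execMonitor b i j k (τ ++ [e]) =
      (execMonitor b i j k τ).step (execLetter b i j k e) := by
  simp [execMonitor]

/-- Paths in the product of the table with a monitor are exactly the traces of binary runs, paired
with the monitor states along them. -/
theorem check_iff_of_describes (hx : x₀ ≠ x₁) {T : Table} (hT : T.Describes A x₀ x₁) :
    T.check = true ↔ ∀ τ, A.IsExec τ → IsBinaryExec x₀ x₁ τ → ∀ i j k,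
      ¬ (execMonitor (A.highValue x₀ x₁) i j k τ).accepts = true := by
  obtain ⟨σ, enc, hσ, hinj, h0, h1, hprocs, hinit, hstart, htrans⟩ := hT
  set b := A.highValue x₀ x₁ with hb
  have hx₀ : x₀ ∈ A.binaryValues x₀ x₁ := Or.inl (Or.inl (Or.inl rfl))
  have hx₁ : x₁ ∈ A.binaryValues x₀ x₁ := Or.inl (Or.inl (Or.inr rfl))
  have hbmem : ∀ m, b m ∈ A.binaryValues x₀ x₁ := fun m => by
    simp only [hb, highValue]
    split_ifs
    exacts [hx₀, hx₁]
  have hhigh : ∀ m : Fin n, T.highValue m = enc (b m) := fun m => by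
    have hget : T.initVals.getD m 0 = enc (A.initVal m) := by
      simp [hinit]
    have hiff : enc (A.initVal m) = 1 ↔ A.initVal m = x₁ := by
      rw [← h1]
      exact hinj.eq_iff (Or.inl (Or.inr ⟨m, rfl⟩)) hx₁
    rw [Table.highValue, hget, hb, highValue]
    by_cases h : A.initVal m = x₁
    · rw [if_pos h, if_pos (hiff.2 h), h0]
    · rw [if_neg h, if_neg (mt hiff.1 h), h1]
  have hletter : ∀ {s s' : A.State} {p : Fin n} {a : Action V (Fin n → V)},
      s ∈ A.binaryStates x₀ x₁ → A.Step s p a s' → a.IsBinary x₀ x₁ → ∀ i j k : Fin n,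
      observe (i : ℕ) (j : ℕ) (k : ℕ) (T.highValue i) (T.highValue j) (fun z => z.getD i 0)
          (fun z => z.getD j 0) ((p : ℕ), a.map enc (fun z => List.ofFn (fun k => enc (z k)))) =
        execLetter b i j k (p, a) := fun {s s' p a} hs hstep ha i j k => by
    rw [hhigh, hhigh]
    refine observe_map (fun x hxa m => hinj.eq_iff ?_ (hbmem m))
      (fun z hza m => hinj.eq_iff ?_ (hbmem m)) i j k
    · subst hxa
      rcases ha with rfl | rfl
      exacts [hx₀, hx₁]
    · subst hza
      exact Or.inr ⟨s, hs, p, z, s', hstep, m, rfl⟩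
  have hreach : ∀ (i j k : Fin n) (x : ℕ × Monitor),
      Relation.ReflTransGen (ProductStep (T.letterTrans i j k)) (T.start, .init) x ↔
        ∃ τ s, IsBinaryExec x₀ x₁ τ ∧ A.Run τ s ∧ x = (σ s, execMonitor b i j k τ) := by
    intro i j k x
    constructor
    · intro h
      induction h with
      | refl => exact ⟨[], A.initState, by simp [IsBinaryExec], .nil, by rw [hstart]; rfl⟩
      | @tail x y _ hxy ih =>
        obtain ⟨τ, s, hτ, hrun, rfl⟩ := ih
        obtain ⟨c, hc, hy⟩ := hxy
        obtain ⟨e, he, hec⟩ := List.mem_map.1 hc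
        obtain ⟨s₁, hs₁, p, a, s', hstep, ha, rfl⟩ := (htrans e).1 he
        simp only [Prod.mk.injEq] at hec
        obtain ⟨hs, rfl, hs'⟩ := hec
        -- The table entry provides only a source state with the same name; injectivity on reachable
        -- states identifies it with the end of the run, so the run can be extended.
        obtain rfl := hσ hs₁ ⟨τ, hτ, hrun⟩ hs
        refine ⟨τ ++ [(p, a)], s', isBinaryExec_snoc.2 ⟨hτ, ha⟩, hrun.snoc hstep, ?_⟩
        refine Prod.ext hs'.symm ?_
        rw [hy, execMonitor_snoc, hletter hs₁ hstep ha]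
    · rintro ⟨τ, s, hτ, hrun, rfl⟩
      induction hrun with
      | nil =>
        rw [hstart]
        exact .refl
      | @snoc τ s p a s' hrun hstep ih =>
        obtain ⟨hτ, ha⟩ := isBinaryExec_snoc.1 hτ
        refine (ih hτ).tail ⟨execLetter b i j k (p, a), ?_, execMonitor_snoc ..⟩
        have hs : s ∈ A.binaryStates x₀ x₁ := ⟨τ, hτ, hrun⟩
        refine List.mem_map.2 ⟨_, (htrans _).2 ⟨s, hs, p, a, s', hstep, ha, rfl⟩, ?_⟩
        simp only [hletter hs hstep ha]
  rw [Table.check_eq_true, hprocs]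
  constructor
  · rintro h τ ⟨s, hs⟩ hτ i j k
    exact h i i.2 j j.2 k k.2 _ ((hreach i j k _).2 ⟨τ, s, hτ, hs, rfl⟩)
  · intro h i hi j hj k hk x hreach'
    obtain ⟨τ, s, hτ, hs, rfl⟩ := (hreach ⟨i, hi⟩ ⟨j, hj⟩ ⟨k, hk⟩ x).1 hreach'
    exact h τ ⟨s, hs⟩ hτ _ _ _

end Algorithm

end Snapshot

theorem mainTheorem4 :
    ∃ decide : Snapshot.Table → Bool, Computable decide ∧
      ∀ (n : ℕ) (V : Type u) (x₀ x₁ : V), x₀ ≠ x₁ →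
      ∀ A : Snapshot.Algorithm.{u, v, w} n V,
        A.ScheduleBased → A.ArgumentsDoNotBlock → A.IsFinite x₀ x₁ →
          (∃ T : Snapshot.Table, T.Describes A x₀ x₁) ∧
          ∀ T : Snapshot.Table, T.Describes A x₀ x₁ → (decide T = true ↔ A.Correct) :=
  ⟨Snapshot.Table.check, Snapshot.computable_check, fun _ _ _ _ hx _ hS hB hF =>
    ⟨Snapshot.Algorithm.exists_describes hS hF hx, fun _ hT =>
      (Snapshot.Algorithm.check_iff_of_describes hx hT).trans
        (Snapshot.Algorithm.correct_iff_forall_accepts hS hB hx).symm⟩⟩
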